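/- Let $n\ge 1$, $q\in[0,n)$, let $\Omega\subset\mathbb R^n$ be a non-empty bounded open convex set and let $g$ be a bounded, strictly positive measurable function on $\Omega$. A \emph{solution} is a function $v\in C(\overline\Omega)$, convex and non-negative in $\Omega$, that satisfies $$\det D^2 v = g\,v^q\chi_{\{v>0\}}\quad\text{in }\Omega$$ in the sense of Aleksandrov, i.e. $|\partial v(A)|=\int_A g\,v^q\chi_{\{v>0\}}\,dx$ for every Borel set $A\subset\Omega$, where $\partial v$ is the subdifferential of $v$ on $\Omega$. A function is called linear on a set if it agrees there with an affine function, $F^{ext}$ denotes the set of extreme points of $F$, and $\Sigma_v$ is the union of all convex sets $F\subset\Omega$ on which $v$ is linear and for which $(\overline F)^{ext}\subset\partial\Omega$. Let $v$ be a solution, and let $E\subset\Sigma_v$ be a convex set on which $v$ is linear and such that $(\overline E)^{ext}\subset\partial\Omega$; exclude only the trivial case in which both $v\equiv 0$ and $E=\Omega$. Then there exists a family of solutions $\{v_t\}_{t>0}$ (for the same $\Omega$, $g$, $q$) such that (i) $v_t\to v$ uniformly on $\overline\Omega$ as $t\to0^+$; (ii) $v_t\ge v$ on $\overline\Omega$ and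 $v_t\not\equiv v$ in $\Omega$, for every $t>0$; (iii) $v_t=v$ on $E$, for every $t>0$. If moreover $E\subset\partial K$, where $K=\{x\in\Omega: v(x)=0\}$, then also $E\subset\partial\{x\in\Omega: v_t(x)=0\}$ for every $t>0$. -/

import Mathlib

open Set Filter Topology MeasureTheory

namespace MongeAmpereObstacle

/-- The subdifferential at `x` of a function `v` on the domain `Ω`. -/
def subdifferential {n : ℕ} (Ω : Set (EuclideanSpace ℝ (Fin n)))
    (v : EuclideanSpace ℝ (Fin n) → ℝ) (x : EuclideanSpace ℝ (Fin n)) :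
    Set (EuclideanSpace ℝ (Fin n)) :=
  {p | ∀ y ∈ Ω, v x + inner ℝ p (y - x) ≤ v y}

/-- The Monge-Ampère measure of `v` on a set `A`: the Lebesgue measure of `∂v(A)`. -/
noncomputable def mongeAmpere {n : ℕ} (Ω : Set (EuclideanSpace ℝ (Fin n)))
    (v : EuclideanSpace ℝ (Fin n) → ℝ) (A : Set (EuclideanSpace ℝ (Fin n))) : ENNReal :=
  volume (⋃ x ∈ A, subdifferential Ω v x)

open Classical in
/-- Convex Aleksandrov solutions `v ≥ 0`, continuous up to the boundary, of
`det D² v = g v^q χ_{v > 0}` in `Ω`. -/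
structure IsSolution {n : ℕ} (Ω : Set (EuclideanSpace ℝ (Fin n)))
    (g : EuclideanSpace ℝ (Fin n) → ℝ) (q : ℝ) (v : EuclideanSpace ℝ (Fin n) → ℝ) : Prop where
  convexOn : ConvexOn ℝ Ω v
  continuousOn : ContinuousOn v (closure Ω)
  nonneg : ∀ x ∈ Ω, 0 ≤ v x
  equation : ∀ A : Set (EuclideanSpace ℝ (Fin n)), MeasurableSet A → A ⊆ Ω →
    mongeAmpere Ω v A =
      ∫⁻ x in A, ENNReal.ofReal (if 0 < v x then g x * v x ^ q else 0)

/-- The coincidence set `K = {x ∈ Ω : v(x) = 0}`. -/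
def coincidenceSet {n : ℕ} (Ω : Set (EuclideanSpace ℝ (Fin n)))
    (v : EuclideanSpace ℝ (Fin n) → ℝ) : Set (EuclideanSpace ℝ (Fin n)) :=
  {x | x ∈ Ω ∧ v x = 0}

/-- `v` is linear on `E`, that is, it agrees there with an affine function. -/
def IsLinearOn {n : ℕ} (v : EuclideanSpace ℝ (Fin n) → ℝ)
    (E : Set (EuclideanSpace ℝ (Fin n))) : Prop :=
  ∃ (p : EuclideanSpace ℝ (Fin n)) (c : ℝ), ∀ x ∈ E, v x = inner ℝ p x + c

/-- The set `Σ_v`: the union of all convex sets `F ⊆ Ω` on which `v` is linear and for which all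
extreme points of the closure of `F` lie on `∂Ω`. -/
def singularSet {n : ℕ} (Ω : Set (EuclideanSpace ℝ (Fin n)))
    (v : EuclideanSpace ℝ (Fin n) → ℝ) : Set (EuclideanSpace ℝ (Fin n)) :=
  ⋃₀ {F | F ⊆ Ω ∧ Convex ℝ F ∧ IsLinearOn v F ∧
    (closure F).extremePoints ℝ ⊆ frontier Ω}

end MongeAmpereObstacle

/-! The family comes from perturbing boundary data. Unless `E = Ω` and `v ≡ 0`, some `y ∈ Ω` lies
outside `closure E`. A hyperplane separating it from `closure E` gives a convex `h ≥ 0`, the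
positive part of an affine function, with `h = 0` on `closure E` and `h y > 0`. Let `w t` be the
solution with boundary values `v + t h`. The comparison principle gives `v ≤ w t ≤ v + t H`, where
`H` bounds `h`, hence uniform convergence. A linear function has its maximum over `closure Ω` on the
frontier, so `h > 0` at some boundary point and `w t ≠ v`. On `closure E`, `w t` is convex and
equals the affine function `v` at the extreme points, which lie on `∂Ω`, so `w t ≤ v` there by
Krein–Milman. Ordering of the functions shrinks the coincidence set, so its boundary keeps `E`.

Comparison (`IsSolution.le_add_of_frontier`) uses scaling: multiplying `u` by `1 + ε` multiplies its
Monge–Ampère measure by `(1 + ε) ^ n` but `u ^ q` only by `(1 + ε) ^ q`, and `q < n`.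

Existence (`exists_isSolution`) is variational. With `w*` the Legendre conjugate, the functional `∫
(w* - φ*) + ∫ g w ^ (q + 1) / (q + 1)` is submodular and lower semicontinuous under pointwise
limits, so lattice operations replace compactness (`exists_minimizer`). Biconjugation makes the
minimizer convex, finiteness of the energy gives the lower bound at the boundary
(`eventually_sub_le_of_conjGap`), and variations `u ± ε 1_U` give the equation. -/

namespace MongeAmpereObstacle

/-! ### Convex conjugates on bounded sets. -/

section Conjugate

variable {E : Type*} [NormedAddCommGroup E] [InnerProductSpace ℝ E]

/-- The convex conjugate of `w` relative to the set `S`. -/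
noncomputable def conj (S : Set E) (w : E → ℝ) (p : E) : ℝ :=
  ⨆ x : S, (inner ℝ p (x : E) - w x)

variable {S T : Set E} {w w' : E → ℝ} {R : ℝ}

lemma bddAbove_conj (hR : ∀ x ∈ S, ‖x‖ ≤ R) (hw : ∀ x ∈ S, 0 ≤ w x) (p : E) :
    BddAbove (range fun x : S => inner ℝ p (x : E) - w x) := by
  refine ⟨‖p‖ * R, ?_⟩
  rintro _ ⟨x, rfl⟩
  have h1 := real_inner_le_norm p (x : E)
  have h2 := mul_le_mul_of_nonneg_left (hR x x.2) (norm_nonneg p)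
  have h3 := hw x x.2
  simp only
  linarith

lemma le_conj (hR : ∀ x ∈ S, ‖x‖ ≤ R) (hw : ∀ x ∈ S, 0 ≤ w x) (p : E) {x : E} (hx : x ∈ S) :
    inner ℝ p x - w x ≤ conj S w p :=
  le_ciSup (bddAbove_conj hR hw p) (⟨x, hx⟩ : S)

lemma conj_le (hS : S.Nonempty) {p : E} {c : ℝ} (h : ∀ x ∈ S, inner ℝ p x - w x ≤ c) :
    conj S w p ≤ c := by
  have := hS.to_subtype
  exact ciSup_le fun x => h x x.2

lemma conj_le_conj_add (hS : S.Nonempty) (hR : ∀ x ∈ S, ‖x‖ ≤ R) (hw : ∀ x ∈ S, 0 ≤ w x)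
    {c : ℝ} (h : ∀ x ∈ S, w x ≤ w' x + c) (p : E) :
    conj S w' p ≤ conj S w p + c := by
  refine conj_le hS fun x hx => ?_
  have := le_conj hR hw p hx
  linarith [h x hx]

lemma conj_anti (hS : S.Nonempty) (hR : ∀ x ∈ S, ‖x‖ ≤ R) (hw : ∀ x ∈ S, 0 ≤ w x)
    (h : ∀ x ∈ S, w x ≤ w' x) (p : E) : conj S w' p ≤ conj S w p := by
  simpa using conj_le_conj_add (c := 0) hS hR hw (by simpa using h) p

/-- A supremum of affine functions of `p` with slopes `x`, `‖x‖ ≤ R`. This yields both measurability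
and, through Rademacher, differentiability almost everywhere. -/
lemma lipschitzWith_conj (hS : S.Nonempty) (hR : ∀ x ∈ S, ‖x‖ ≤ R) (hw : ∀ x ∈ S, 0 ≤ w x) :
    LipschitzWith R.toNNReal (conj S w) := by
  refine LipschitzWith.of_le_add_mul _ fun p p' => ?_
  refine conj_le hS fun x hx => ?_
  have h1 := le_conj hR hw p' hx
  have h2 : inner ℝ p x = inner ℝ p' x + inner ℝ (p - p') x := by rw [inner_sub_left]; ring
  have h3 := real_inner_le_norm (p - p') x
  have h4 := mul_le_mul_of_nonneg_left (hR x hx) (norm_nonneg (p - p'))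
  have h0 : 0 ≤ R := (norm_nonneg x).trans (hR x hx)
  rw [Real.coe_toNNReal _ h0, dist_eq_norm]
  linarith

lemma measurable_conj [MeasurableSpace E] [BorelSpace E]
    (hS : S.Nonempty) (hR : ∀ x ∈ S, ‖x‖ ≤ R) (hw : ∀ x ∈ S, 0 ≤ w x) :
    Measurable (conj S w) :=
  (lipschitzWith_conj hS hR hw).continuous.measurable

/-- The slopes at which the supremum defining the conjugate is attained at two distinct points
form a null set. -/
lemma volume_setOf_two_maximizers [FiniteDimensional ℝ E] [MeasurableSpace E] [BorelSpace E]
    (hR : ∀ x ∈ S, ‖x‖ ≤ R) (hw : ∀ x ∈ S, 0 ≤ w x) :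
    volume {p : E | ∃ x ∈ S, ∃ y ∈ S, x ≠ y ∧ inner ℝ p x - w x = conj S w p ∧
      inner ℝ p y - w y = conj S w p} = 0 := by
  rcases S.eq_empty_or_nonempty with rfl | hS
  · simp
  have hd := (lipschitzWith_conj hS hR hw).ae_differentiableAt (μ := volume)
  refine measure_mono_null ?_ hd
  rintro p ⟨x, hx, y, hy, hxy, hpx, hpy⟩ hp
  apply hxy
  -- The function `conj S w - ⟨·, z⟩` has a global minimum at `p` when `z` is a maximizer, so the
  -- gradient at `p` is `z`; two maximizers would give two gradients.
  have key : ∀ z ∈ S, inner ℝ p z - w z = conj S w p →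
      fderiv ℝ (conj S w) p = innerSL ℝ z := by
    intro z hz hpz
    have hmin : IsLocalMin (fun p' => conj S w p' - inner ℝ p' z) p := by
      refine Filter.Eventually.of_forall fun p' => ?_
      have := le_conj hR hw p' hz
      simp only
      linarith
    have h1 : HasFDerivAt (fun p' => conj S w p' - inner ℝ p' z)
        (fderiv ℝ (conj S w) p - innerSL ℝ z) p := by
      refine hp.hasFDerivAt.sub ?_
      have := (innerSL ℝ z).hasFDerivAt (x := p)
      refine this.congr_of_eventuallyEq (Filter.Eventually.of_forall fun p' => ?_)
      simp [real_inner_comm]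
    exact sub_eq_zero.mp (hmin.hasFDerivAt_eq_zero h1)
  have h2 : innerSL ℝ x = innerSL ℝ y := (key x hx hpx).symm.trans (key y hy hpy)
  refine ext_inner_right ℝ fun z => ?_
  have := congrArg (fun f => f z) h2
  simpa using this

end Conjugate

/-! ### The potential `s ^ (q + 1) / (q + 1)`. -/

section Power

variable {q a b : ℝ}

/-- The primitive of `s ↦ s ^ q`. -/
noncomputable def primitive (q s : ℝ) : ℝ := s ^ (q + 1) / (q + 1)

lemma primitive_nonneg (hq : 0 ≤ q) (ha : 0 ≤ a) : 0 ≤ primitive q a := by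
  unfold primitive; positivity

lemma primitive_le_primitive (hq : 0 ≤ q) (ha : 0 ≤ a) (hab : a ≤ b) :
    primitive q a ≤ primitive q b := by
  unfold primitive; gcongr

lemma measurable_primitive : Measurable (primitive q) := by
  unfold primitive; fun_prop

/-- The tangent line inequality for a convex function, here as Young's inequality with weights `q /
(q + 1)` and `1 / (q + 1)`. The tangent will be taken at the perturbed value, so that each variation
gives an exact one-sided bound. -/
lemma rpow_mul_sub_le_primitive_sub (hq : 0 ≤ q) (ha : 0 ≤ a) (hb : 0 ≤ b) :
    a ^ q * (b - a) ≤ primitive q b - primitive q a := by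
  have hq1 : 0 < q + 1 := by linarith
  have h := Real.geom_mean_le_arith_mean2_weighted (w₁ := q / (q + 1)) (w₂ := 1 / (q + 1))
    (p₁ := a ^ (q + 1)) (p₂ := b ^ (q + 1)) (by positivity) (by positivity) (by positivity)
    (by positivity) (by field_simp)
  rw [← Real.rpow_mul ha, ← Real.rpow_mul hb, mul_div_cancel₀ _ hq1.ne',
    mul_div_cancel₀ _ hq1.ne', Real.rpow_one] at h
  have h3 : a ^ (q + 1) = a ^ q * a := by
    rw [Real.rpow_add' ha hq1.ne', Real.rpow_one]
  unfold primitive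
  rw [h3] at h ⊢
  have h4 : a ^ q * a = q / (q + 1) * (a ^ q * a) + a ^ q * a / (q + 1) := by field_simp
  have h5 : 1 / (q + 1) * b ^ (q + 1) = b ^ (q + 1) / (q + 1) := by ring
  linarith

end Power

/-! ### The energy and its minimizer. -/

section Energy

variable {E : Type*} [NormedAddCommGroup E] [InnerProductSpace ℝ E] [FiniteDimensional ℝ E]
  [MeasurableSpace E] [BorelSpace E]

/-- Competitors in the variational problem: functions with values in `[0, M]` that agree with `φ`
on the boundary. -/
structure Admissible (Ω : Set E) (φ : E → ℝ) (M : ℝ) (w : E → ℝ) : Prop where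
  aemeasurable : AEMeasurable w (volume.restrict Ω)
  eq_on_frontier : ∀ x ∈ frontier Ω, w x = φ x
  nonneg : ∀ x ∈ closure Ω, 0 ≤ w x
  le : ∀ x ∈ closure Ω, w x ≤ M

/-- The excess of the conjugate of `w` over the conjugate of its boundary values. -/
noncomputable def conjGap (Ω : Set E) (φ w : E → ℝ) (p : E) : ENNReal :=
  ENNReal.ofReal (conj (closure Ω) w p - conj (frontier Ω) φ p)

/-- The potential part of the energy. -/
noncomputable def potential (Ω : Set E) (g : E → ℝ) (q : ℝ) (w : E → ℝ) : ENNReal :=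
  ∫⁻ x in Ω, ENNReal.ofReal (g x * primitive q (w x))

/-- The convex functional whose Euler-Lagrange equation is `det D² w = g w ^ q`. -/
noncomputable def energy (Ω : Set E) (g : E → ℝ) (q : ℝ) (φ w : E → ℝ) : ENNReal :=
  (∫⁻ p, conjGap Ω φ w p) + potential Ω g q w

variable {Ω : Set E} {φ g w w' : E → ℝ} {q M R : ℝ}

lemma Admissible.sup (hw : Admissible Ω φ M w) (hw' : Admissible Ω φ M w') :
    Admissible Ω φ M (w ⊔ w') where
  aemeasurable := hw.aemeasurable.sup hw'.aemeasurable
  eq_on_frontier x hx := by simp [hw.eq_on_frontier x hx, hw'.eq_on_frontier x hx]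
  nonneg x hx := le_sup_of_le_left (hw.nonneg x hx)
  le x hx := sup_le (hw.le x hx) (hw'.le x hx)

lemma Admissible.inf (hw : Admissible Ω φ M w) (hw' : Admissible Ω φ M w') :
    Admissible Ω φ M (w ⊓ w') where
  aemeasurable := hw.aemeasurable.inf hw'.aemeasurable
  eq_on_frontier x hx := by simp [hw.eq_on_frontier x hx, hw'.eq_on_frontier x hx]
  nonneg x hx := le_inf (hw.nonneg x hx) (hw'.nonneg x hx)
  le x hx := inf_le_of_left_le (hw.le x hx)

lemma Admissible.of_tendsto {W : ℕ → E → ℝ} (hΩ : MeasurableSet Ω)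
    (hW : ∀ k, Admissible Ω φ M (W k))
    (hlim : ∀ x ∈ closure Ω, Tendsto (fun k => W k x) atTop (𝓝 (w x))) :
    Admissible Ω φ M w where
  aemeasurable := by
    refine aemeasurable_of_tendsto_metrizable_ae atTop (fun k => (hW k).aemeasurable) ?_
    filter_upwards [ae_restrict_mem hΩ] with x hx using hlim x (subset_closure hx)
  eq_on_frontier x hx := by
    refine tendsto_nhds_unique (hlim x (frontier_subset_closure hx)) ?_
    simp [(hW _).eq_on_frontier x hx]
  nonneg x hx := ge_of_tendsto' (hlim x hx) fun k => (hW k).nonneg x hx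
  le x hx := le_of_tendsto' (hlim x hx) fun k => (hW k).le x hx

lemma frontier_nonneg (hw : Admissible Ω φ M w) : ∀ x ∈ frontier Ω, 0 ≤ φ x := fun x hx => by
  rw [← hw.eq_on_frontier x hx]; exact hw.nonneg x (frontier_subset_closure hx)

lemma Admissible.measurable_conj (hw : Admissible Ω φ M w) (hF : (frontier Ω).Nonempty)
    (hR : ∀ x ∈ closure Ω, ‖x‖ ≤ R) : Measurable (conj (closure Ω) w) :=
  MongeAmpereObstacle.measurable_conj (hF.mono frontier_subset_closure) hR hw.nonneg

lemma Admissible.measurable_conjGap (hw : Admissible Ω φ M w) (hF : (frontier Ω).Nonempty)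
    (hR : ∀ x ∈ closure Ω, ‖x‖ ≤ R) : Measurable (conjGap Ω φ w) :=
  ((hw.measurable_conj hF hR).sub (MongeAmpereObstacle.measurable_conj hF
    (fun x hx => hR x (frontier_subset_closure hx)) (frontier_nonneg hw))).ennreal_ofReal

lemma Admissible.conj_frontier_le (hw : Admissible Ω φ M w) (hF : (frontier Ω).Nonempty)
    (hR : ∀ x ∈ closure Ω, ‖x‖ ≤ R) (p : E) :
    conj (frontier Ω) φ p ≤ conj (closure Ω) w p :=
  conj_le hF fun x hx => by
    rw [← hw.eq_on_frontier x hx]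
    exact le_conj hR hw.nonneg p (frontier_subset_closure hx)

lemma Admissible.aemeasurable_potential (hw : Admissible Ω φ M w)
    (hg : AEMeasurable g (volume.restrict Ω)) :
    AEMeasurable (fun x => ENNReal.ofReal (g x * primitive q (w x))) (volume.restrict Ω) :=
  (hg.mul (measurable_primitive.comp_aemeasurable hw.aemeasurable)).ennreal_ofReal

/-- The energy is submodular. -/
lemma energy_sup_add_energy_inf_le (hF : (frontier Ω).Nonempty)
    (hR : ∀ x ∈ closure Ω, ‖x‖ ≤ R) (hg : AEMeasurable g (volume.restrict Ω))
    (hw : Admissible Ω φ M w) (hw' : Admissible Ω φ M w') :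
    energy Ω g q φ (w ⊔ w') + energy Ω g q φ (w ⊓ w') ≤
      energy Ω g q φ w + energy Ω g q φ w' := by
  have hC := hF.mono frontier_subset_closure
  have h1 : (∫⁻ p, conjGap Ω φ (w ⊔ w') p) + (∫⁻ p, conjGap Ω φ (w ⊓ w') p) ≤
      (∫⁻ p, conjGap Ω φ w p) + ∫⁻ p, conjGap Ω φ w' p := by
    rw [← lintegral_add_left ((hw.sup hw').measurable_conjGap hF hR),
      ← lintegral_add_left (hw.measurable_conjGap hF hR)]
    refine lintegral_mono fun p => ?_
    have e1 : conj (closure Ω) (w ⊔ w') p ≤ conj (closure Ω) w p :=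
      conj_anti hC hR hw.nonneg (fun x _ => le_sup_left) p
    have e2 : conj (closure Ω) (w ⊔ w') p ≤ conj (closure Ω) w' p :=
      conj_anti hC hR hw'.nonneg (fun x _ => le_sup_right) p
    -- Pointwise the infimum is one of the two functions, so its conjugate is at most the maximum of
    -- the conjugates, while that of the supremum is at most their minimum.
    have e3 : conj (closure Ω) (w ⊓ w') p ≤ max (conj (closure Ω) w p) (conj (closure Ω) w' p) := by
      refine conj_le hC fun x hx => ?_
      rcases le_total (w x) (w' x) with h | h
      · refine le_max_of_le_left ?_
        simpa [h] using le_conj hR hw.nonneg p hx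
      · refine le_max_of_le_right ?_
        simpa [h] using le_conj hR hw'.nonneg p hx
    unfold conjGap
    rcases le_total (conj (closure Ω) w p) (conj (closure Ω) w' p) with h | h
    · rw [max_eq_right h] at e3
      gcongr
    · rw [max_eq_left h] at e3
      rw [add_comm]
      gcongr
  have h2 : potential Ω g q (w ⊔ w') + potential Ω g q (w ⊓ w') =
      potential Ω g q w + potential Ω g q w' := by
    unfold potential
    rw [← lintegral_add_left' ((hw.sup hw').aemeasurable_potential hg),
      ← lintegral_add_left' (hw.aemeasurable_potential hg)]
    refine lintegral_congr fun x => ?_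
    rcases le_total (w x) (w' x) with h | h
    · simp [h, add_comm]
    · simp [h]
  unfold energy
  rw [add_add_add_comm, h2, add_add_add_comm (∫⁻ p, conjGap Ω φ w p)]
  gcongr

/-- The energy is lower semicontinuous along pointwise convergent sequences. -/
lemma energy_le_of_tendsto {W : ℕ → E → ℝ} (hΩ : MeasurableSet Ω) (hF : (frontier Ω).Nonempty)
    (hR : ∀ x ∈ closure Ω, ‖x‖ ≤ R) (hg : AEMeasurable g (volume.restrict Ω)) (hq : 0 ≤ q)
    (hW : ∀ k, Admissible Ω φ M (W k))
    (hlim : ∀ x ∈ closure Ω, Tendsto (fun k => W k x) atTop (𝓝 (w x)))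
    {c : ℕ → ENNReal} {c' : ENNReal} (hc : ∀ k, energy Ω g q φ (W k) ≤ c k)
    (hc' : Tendsto c atTop (𝓝 c')) : energy Ω g q φ w ≤ c' := by
  have h1 : ∫⁻ p, conjGap Ω φ w p ≤ liminf (fun k => ∫⁻ p, conjGap Ω φ (W k) p) atTop := by
    refine le_trans (lintegral_mono fun p => ?_)
      (lintegral_liminf_le fun k => (hW k).measurable_conjGap hF hR)
    refine le_of_forall_lt fun a ha => ?_
    have hat : a ≠ ⊤ := (lt_of_lt_of_le ha le_top).ne
    rw [conjGap, ENNReal.lt_ofReal_iff_toReal_lt hat] at ha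
    obtain ⟨b, hab, hb⟩ := exists_between ha
    -- A single nearly optimal `x` suffices: it bounds the conjugates of all late `W k` from below.
    have : ∃ x ∈ closure Ω, b + conj (frontier Ω) φ p < inner ℝ p x - w x := by
      by_contra! hcon
      have := conj_le (hF.mono frontier_subset_closure) hcon
      linarith
    obtain ⟨x, hx, hbx⟩ := this
    have hl : Tendsto (fun k => inner ℝ p x - W k x) atTop (𝓝 (inner ℝ p x - w x)) :=
      tendsto_const_nhds.sub (hlim x hx)
    have hev := hl.eventually (lt_mem_nhds hbx)
    refine lt_of_lt_of_le ((ENNReal.lt_ofReal_iff_toReal_lt hat).2 hab :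
      a < ENNReal.ofReal b) ?_
    refine le_liminf_of_le (by isBoundedDefault) ?_
    filter_upwards [hev] with k hk
    refine ENNReal.ofReal_le_ofReal ?_
    have := le_conj hR (hW k).nonneg p hx
    linarith
  have h2 : potential Ω g q w ≤ liminf (fun k => potential Ω g q (W k)) atTop := by
    refine le_trans (lintegral_mono_ae ?_)
      (lintegral_liminf_le' fun k => (hW k).aemeasurable_potential hg)
    filter_upwards [ae_restrict_mem hΩ] with x hx
    refine le_of_eq (Tendsto.liminf_eq ?_).symm
    refine ENNReal.tendsto_ofReal (tendsto_const_nhds.mul ?_)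
    have h3 := hlim x (subset_closure hx)
    unfold primitive
    exact (h3.rpow_const (Or.inr (by linarith))).div_const _
  calc energy Ω g q φ w ≤ liminf (fun k => ∫⁻ p, conjGap Ω φ (W k) p) atTop +
        liminf (fun k => potential Ω g q (W k)) atTop := add_le_add h1 h2
    _ ≤ liminf (fun k => energy Ω g q φ (W k)) atTop := by
      simp only [liminf_eq_iSup_iInf_of_nat]
      rw [ENNReal.iSup_add_iSup_of_monotone]
      · refine iSup_mono fun k => le_iInf₂ fun i hi => ?_
        exact add_le_add (iInf₂_le i hi) (iInf₂_le i hi)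
      · exact fun a b hab => le_iInf₂ fun i hi => iInf₂_le i (hab.trans hi)
      · exact fun a b hab => le_iInf₂ fun i hi => iInf₂_le i (hab.trans hi)
    _ ≤ liminf c atTop := liminf_le_liminf (Eventually.of_forall hc)
    _ = c' := hc'.liminf_eq

/-- The energy attains its minimum over the admissible functions. -/
theorem exists_minimizer (hΩ : MeasurableSet Ω) (hF : (frontier Ω).Nonempty)
    (hR : ∀ x ∈ closure Ω, ‖x‖ ≤ R) (hg : AEMeasurable g (volume.restrict Ω)) (hq : 0 ≤ q)
    {w₀ : E → ℝ} (hw₀ : Admissible Ω φ M w₀) :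
    ∃ W, Admissible Ω φ M W ∧
      ∀ w, Admissible Ω φ M w → energy Ω g q φ W ≤ energy Ω g q φ w := by
  set J := energy Ω g q φ
  set m : ENNReal := ⨅ w : {w // Admissible Ω φ M w}, J w with hm
  have hmle : ∀ w, Admissible Ω φ M w → m ≤ J w := fun w hw => iInf_le_of_le ⟨w, hw⟩ le_rfl
  by_cases hmt : m = ⊤
  · exact ⟨w₀, hw₀, fun w hw => by
      have := hmle w hw
      rw [hmt, top_le_iff] at this
      rw [this]; exact le_top⟩
  -- Summable errors `2 ^ (-k)`: joining successive near-minimizers then costs a bounded total, and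
  -- `limsup w k` will be the minimizer.
  let δ : ℕ → ENNReal := fun k => 2⁻¹ ^ k
  have hδ0 : ∀ k, δ k ≠ 0 := fun k => pow_ne_zero _ (by simp)
  have hδ : ∀ k, δ (k + 1) + δ (k + 1) = δ k := fun k => by
    change (2⁻¹ : ENNReal) ^ (k + 1) + 2⁻¹ ^ (k + 1) = 2⁻¹ ^ k
    rw [pow_succ, ← mul_add, ENNReal.inv_two_add_inv_two, mul_one]
  have hex : ∀ k, ∃ w, Admissible Ω φ M w ∧ J w ≤ m + δ k := fun k => by
    have : m < m + δ k := ENNReal.lt_add_right hmt (hδ0 k)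
    obtain ⟨w, hw⟩ := iInf_lt_iff.1 (hm ▸ this)
    exact ⟨w, w.2, hw.le⟩
  choose w hw hJw using hex
  let V : ℕ → ℕ → E → ℝ := fun k l => partialSups (fun j => w (k + j)) l
  have hVsucc : ∀ k l, V k (l + 1) = V k l ⊔ w (k + (l + 1)) := fun k l => partialSups_succ _ _
  have hV : ∀ k l, Admissible Ω φ M (V k l) := by
    intro k l
    induction l with
    | zero => simpa [V] using hw k
    | succ l ih => rw [hVsucc]; exact ih.sup (hw _)
  -- The term `δ (k + l)` on the left makes the induction close: by submodularity and minimality of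
  -- `m`, each join costs at most `δ (k + l + 1)`, half of that reserve.
  have hJV : ∀ k l, J (V k l) + δ (k + l) ≤ m + (δ k + δ k) := by
    intro k l
    induction l with
    | zero =>
      simp only [V, partialSups_zero, add_zero, ← add_assoc]
      gcongr
      exact hJw k
    | succ l ih =>
      have h1 := energy_sup_add_energy_inf_le (q := q) hF hR hg (hV k l) (hw (k + (l + 1)))
      rw [← hVsucc] at h1
      have h2 : J (V k (l + 1)) ≤ J (V k l) + δ (k + (l + 1)) := by
        refine (ENNReal.add_le_add_iff_right hmt).1 ?_
        calc J (V k (l + 1)) + m ≤ J (V k (l + 1)) + J (V k l ⊓ w (k + (l + 1))) := by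
              gcongr
              exact hmle _ ((hV k l).inf (hw _))
          _ ≤ J (V k l) + J (w (k + (l + 1))) := h1
          _ ≤ J (V k l) + (m + δ (k + (l + 1))) := by gcongr; exact hJw _
          _ = J (V k l) + δ (k + (l + 1)) + m := by ring
      calc J (V k (l + 1)) + δ (k + (l + 1))
          ≤ J (V k l) + δ (k + (l + 1)) + δ (k + (l + 1)) := by gcongr
        _ = J (V k l) + δ (k + l) := by rw [add_assoc]; congr 1; exact hδ (k + l)
        _ ≤ _ := ih
  let W : ℕ → E → ℝ := fun k x => ⨆ l, V k l x
  have hVmono : ∀ k x, Monotone fun l => V k l x := fun k x l l' hl =>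
    (partialSups (fun j => w (k + j))).monotone hl x
  have hbdd : ∀ k, ∀ x ∈ closure Ω, BddAbove (range fun l => V k l x) := fun k x hx =>
    ⟨M, by rintro _ ⟨l, rfl⟩; exact (hV k l).le x hx⟩
  have hVW : ∀ k, ∀ x ∈ closure Ω, Tendsto (fun l => V k l x) atTop (𝓝 (W k x)) := fun k x hx =>
    tendsto_atTop_ciSup (hVmono k x) (hbdd k x hx)
  have hW : ∀ k, Admissible Ω φ M (W k) := fun k => Admissible.of_tendsto hΩ (hV k) (hVW k)
  have hJW : ∀ k, J (W k) ≤ m + (δ k + δ k) := fun k =>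
    energy_le_of_tendsto hΩ hF hR hg hq (hV k) (hVW k)
      (fun l => le_self_add.trans (hJV k l)) tendsto_const_nhds
  -- Raising `k` drops a function from the supremum, so the limit in `k` is again monotone and
  -- pointwise.
  have hWanti : ∀ x ∈ closure Ω, Antitone fun k => W k x := by
    intro x hx
    refine antitone_nat_of_succ_le fun k => ciSup_le fun l => ?_
    refine le_trans ?_ (le_ciSup (hbdd k x hx) (l + 1))
    have : V (k + 1) l ≤ V k (l + 1) := by
      refine partialSups_le _ _ _ fun j hj => ?_
      have := le_partialSups_of_le (fun j => w (k + j)) (Nat.add_le_add_right hj 1)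
      simpa only [add_assoc, add_comm 1] using this
    exact this x
  let U : E → ℝ := fun x => ⨅ k, W k x
  have hWU : ∀ x ∈ closure Ω, Tendsto (fun k => W k x) atTop (𝓝 (U x)) := fun x hx =>
    tendsto_atTop_ciInf (hWanti x hx) ⟨0, by rintro _ ⟨k, rfl⟩; exact (hW k).nonneg x hx⟩
  refine ⟨U, Admissible.of_tendsto hΩ hW hWU, fun w' hw' => le_trans ?_ (hmle w' hw')⟩
  refine energy_le_of_tendsto hΩ hF hR hg hq hW hWU hJW ?_
  have hδt : Tendsto δ atTop (𝓝 0) := ENNReal.tendsto_pow_atTop_nhds_zero_of_lt_one (by simp)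
  simpa using (tendsto_const_nhds (x := m)).add (hδt.add hδt)

end Energy

/-! ### Behaviour at the boundary. -/

section Boundary

variable {E : Type*} [NormedAddCommGroup E] [InnerProductSpace ℝ E]

/-- A linear function on a bounded open set is dominated by its boundary values. -/
lemma exists_frontier_inner_le [FiniteDimensional ℝ E] {Ω : Set E} (hΩo : IsOpen Ω)
    (hΩb : Bornology.IsBounded Ω) (hF : (frontier Ω).Nonempty) {x : E} (hx : x ∈ closure Ω)
    (p : E) : ∃ y ∈ frontier Ω, inner ℝ p x ≤ inner ℝ p y := by
  by_cases hp : p = 0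
  · obtain ⟨y, hy⟩ := hF
    exact ⟨y, hy, by simp [hp]⟩
  have hK : IsCompact (closure Ω) := hΩb.isCompact_closure
  obtain ⟨z, hz, hmax⟩ := hK.exists_isMaxOn ⟨x, hx⟩
    (f := fun y => (inner ℝ p y : ℝ)) (by fun_prop)
  by_cases hzΩ : z ∈ Ω
  · exfalso
    have hc : Tendsto (fun t : ℝ => z + t • p) (𝓝[>] 0) (𝓝 z) := by
      have : Tendsto (fun t : ℝ => z + t • p) (𝓝 0) (𝓝 (z + (0 : ℝ) • p)) :=
        Continuous.tendsto (by fun_prop) 0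
      rw [zero_smul, add_zero] at this
      exact this.mono_left nhdsWithin_le_nhds
    obtain ⟨t, ht, ht0⟩ := ((hc.eventually (hΩo.mem_nhds hzΩ)).and self_mem_nhdsWithin).exists
    have h1 : inner ℝ p (z + t • p) ≤ inner ℝ p z := hmax (subset_closure ht)
    rw [inner_add_right, inner_smul_right, real_inner_self_eq_norm_sq] at h1
    have h2 : 0 < ‖p‖ := norm_pos_iff.2 hp
    have h3 : 0 < t * ‖p‖ ^ 2 := mul_pos ht0 (by positivity)
    linarith
  · exact ⟨z, ⟨hz, by rwa [hΩo.interior_eq]⟩, hmax hx⟩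

/-- A convex function on an open convex set, given through its values on rays from an interior
point, is bounded near the boundary by its boundary values. -/
lemma eventually_le_add_of_ray {Ω : Set E} (hΩo : IsOpen Ω) (hΩc : Convex ℝ Ω)
    {φ u : E → ℝ} {M m : ℝ} {b c : E} (hb : b ∈ frontier Ω) (hc : c ∈ Ω)
    (hφ : ContinuousWithinAt φ (frontier Ω) b)
    (hu : ∀ y ∈ frontier Ω, ∀ r : ℝ, 0 ≤ r → r ≤ 1 → (1 - r) • c + r • y ∈ Ω →
      u ((1 - r) • c + r • y) ≤ r * φ y + (1 - r) * M)
    (hm : 0 < m) : ∀ᶠ x in 𝓝[Ω] b, u x ≤ φ b + m := by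
  -- The gauge of `Ω - c` provides polar coordinates around `c`: `x = (1 - r) c + r y` with `y` on
  -- the frontier, and `r → 1`, `y → b` as `x → b`.
  set D : Set E := (fun z => c + z) ⁻¹' Ω with hD
  have hDo : IsOpen D := hΩo.preimage (by fun_prop)
  have hDc : Convex ℝ D := hΩc.translate_preimage_right c
  have hD0 : D ∈ 𝓝 (0 : E) := hDo.mem_nhds (by simpa [hD] using hc)
  have hfr : ∀ z, z ∈ frontier D ↔ c + z ∈ frontier Ω := fun z => by
    have := (Homeomorph.addLeft c).preimage_frontier Ω
    exact (Set.ext_iff.1 this z).symm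
  let r : E → ℝ := fun x => gauge D (x - c)
  have hrc : Continuous r := (continuous_gauge hDc hD0).comp (by fun_prop)
  have hrb : r b = 1 := (gauge_eq_one_iff_mem_frontier hDc hD0).2 ((hfr _).2 (by simpa using hb))
  let y : E → E := fun x => c + (r x)⁻¹ • (x - c)
  have hr_pos : ∀ᶠ x in 𝓝[Ω] b, 0 < r x :=
    nhdsWithin_le_nhds (hrc.continuousAt.eventually (lt_mem_nhds (by rw [hrb]; norm_num)))
  have hy : Tendsto y (𝓝[Ω] b) (𝓝 b) := by
    have h1 : ContinuousAt y b := by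
      have : r b ≠ 0 := by rw [hrb]; norm_num
      exact continuousAt_const.add ((hrc.continuousAt.inv₀ this).smul (by fun_prop))
    have h2 : y b = b := by simp [y, hrb]
    have h3 := h1.tendsto
    rw [h2] at h3
    exact h3.mono_left nhdsWithin_le_nhds
  have hyF : ∀ᶠ x in 𝓝[Ω] b, y x ∈ frontier Ω := by
    filter_upwards [hr_pos] with x hx
    refine (hfr _).1 ((gauge_eq_one_iff_mem_frontier hDc hD0).1 ?_)
    rw [gauge_smul_of_nonneg (inv_nonneg.2 hx.le), smul_eq_mul]
    exact inv_mul_cancel₀ hx.ne'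
  have hφy : Tendsto (fun x => φ (y x)) (𝓝[Ω] b) (𝓝 (φ b)) :=
    hφ.tendsto.comp (tendsto_nhdsWithin_iff.2 ⟨hy, hyF⟩)
  have hr1 : Tendsto r (𝓝[Ω] b) (𝓝 1) := by
    rw [← hrb]; exact hrc.continuousAt.tendsto.mono_left nhdsWithin_le_nhds
  have hlim : Tendsto (fun x => r x * φ (y x) + (1 - r x) * M) (𝓝[Ω] b) (𝓝 (φ b)) := by
    have := (hr1.mul hφy).add ((tendsto_const_nhds (x := (1 : ℝ))).sub hr1 |>.mul_const M)
    simpa using this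
  filter_upwards [hr_pos, hyF, hlim.eventually (gt_mem_nhds (show φ b < φ b + m by linarith)),
    self_mem_nhdsWithin] with x hx0 hxF hxl hxΩ
  have hxe : (1 - r x) • c + r x • y x = x := by
    simp only [y, smul_add, smul_smul, mul_inv_cancel₀ hx0.ne', one_smul, sub_smul]
    abel
  have hx1 : r x ≤ 1 := gauge_le_one_of_mem (by simpa [hD] using hxΩ)
  have := hu (y x) hxF (r x) hx0.le hx1 (by rwa [hxe])
  rw [hxe] at this
  linarith

variable [FiniteDimensional ℝ E] [MeasurableSpace E] [BorelSpace E]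
  {Ω : Set E} {φ u : E → ℝ} {M R : ℝ}

/-- If the conjugate of `u` exceeds the conjugate of its boundary values by an integrable function,
then `u` is bounded below near the boundary by its (convex) boundary values. -/
lemma eventually_sub_le_of_conjGap (hΩo : IsOpen Ω) (hΩc : Convex ℝ Ω)
    (hR : ∀ x ∈ closure Ω, ‖x‖ ≤ R) (hφc : ConvexOn ℝ (closure Ω) φ)
    (hφ : ContinuousOn φ (closure Ω)) (hu : Admissible Ω φ M u)
    (hgap : ∫⁻ p, conjGap Ω φ u p ≠ ⊤) {b : E} (hb : b ∈ frontier Ω) {m : ℝ} (hm : 0 < m) :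
    ∀ᶠ x in 𝓝[Ω] b, φ x - m ≤ u x := by
  have hF : (frontier Ω).Nonempty := ⟨b, hb⟩
  have hbΩ : b ∉ Ω := fun h => hb.2 (by rwa [hΩo.interior_eq])
  have hΩne : Ω.Nonempty := closure_nonempty_iff.1 (hF.mono frontier_subset_closure)
  obtain ⟨f, hf⟩ := geometric_hahn_banach_open_point hΩc hΩo hbΩ
  obtain ⟨e, he1, he⟩ : ∃ e : E, ‖e‖ = 1 ∧ ∀ y ∈ closure Ω, inner ℝ e y ≤ inner ℝ e b := by
    set e₀ := (InnerProductSpace.toDual ℝ E).symm f with he₀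
    have hfe : ∀ y, f y = inner ℝ e₀ y := fun y => by
      rw [he₀, InnerProductSpace.toDual_symm_apply]
    have hne : e₀ ≠ 0 := by
      obtain ⟨x, hx⟩ := hΩne
      intro h
      have := hf x hx
      rw [hfe, hfe, h, inner_zero_left, inner_zero_left] at this
      exact lt_irrefl _ this
    refine ⟨‖e₀‖⁻¹ • e₀, norm_smul_inv_norm hne, ?_⟩
    have hcl : IsClosed {y : E | inner ℝ (‖e₀‖⁻¹ • e₀) y ≤ inner ℝ (‖e₀‖⁻¹ • e₀) b} :=
      isClosed_le (by fun_prop) (by fun_prop)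
    refine closure_minimal (fun y hy => ?_) hcl
    have := (hf y hy).le
    rw [hfe, hfe] at this
    change (inner ℝ (‖e₀‖⁻¹ • e₀) y : ℝ) ≤ inner ℝ (‖e₀‖⁻¹ • e₀) b
    rw [real_inner_smul_left, real_inner_smul_left]
    gcongr
  have hR0 : 0 ≤ R := (norm_nonneg b).trans (hR b hb.1)
  -- `R'` bounds the diameter, and `ρ R' = m / 4`, so moving a slope by `ρ` costs at most `m / 4`.
  -- The number `k` of balls of radius `ρ` is taken so large that a gap of `m / 4` on all of them
  -- exceeds the finite integral.
  set R' := 2 * R + 1 with hR'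
  have hR'0 : 0 < R' := by positivity
  set ρ := m / (4 * R') with hρ
  have hρ0 : 0 < ρ := by positivity
  set V : ENNReal := volume (Metric.ball (0 : E) ρ) with hV
  have hV0 : V ≠ 0 := (Metric.measure_ball_pos volume _ hρ0).ne'
  obtain ⟨k, hk⟩ := ENNReal.exists_nat_mul_gt
    (a := ENNReal.ofReal (m / 4) * V) (mul_ne_zero (by simpa using hm) hV0) hgap
  -- Since `x` is close to the supporting hyperplane at `b`, tilting the slope by up to `3 ρ k`
  -- along the outer normal `e` costs at most `m / 4`.
  have hd : ∀ᶠ x in 𝓝[Ω] b, 3 * ρ * k * inner ℝ e (b - x) < m / 4 := by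
    have hc : ContinuousAt (fun x => 3 * ρ * k * (inner ℝ e (b - x) : ℝ)) b := by fun_prop
    refine nhdsWithin_le_nhds (hc.eventually (gt_mem_nhds ?_))
    simp only [sub_self, inner_zero_right, mul_zero]
    positivity
  filter_upwards [hd, self_mem_nhdsWithin] with x hxd hxΩ
  by_contra! hcon
  have hxc : x ∈ closure Ω := subset_closure hxΩ
  obtain ⟨l, c, hl, hlx⟩ := hφc.exists_affine_le_of_lt (𝕜 := ℝ) hxc
    (show φ x - m / 4 < φ x by linarith) isClosed_closure hφ.lowerSemicontinuousOn
  set p₀ := (InnerProductSpace.toDual ℝ E).symm l with hp₀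
  have hlp : ∀ y, l y = inner ℝ p₀ y := fun y => by
    rw [hp₀, InnerProductSpace.toDual_symm_apply]
  have hl' : ∀ y ∈ closure Ω, inner ℝ p₀ y + c ≤ φ y := fun y hy => by
    have := hl ⟨y, hy⟩
    simpa [hlp] using this
  have hlx' : inner ℝ p₀ x + c = φ x - m / 4 := by simpa [hlp] using hlx
  let ctr : ℕ → E := fun j => p₀ + (3 * ρ * j) • e
  have hsub : (⋃ j ∈ Finset.range k, Metric.ball (ctr j) ρ) ⊆
      {p | ENNReal.ofReal (m / 4) ≤ conjGap Ω φ u p} := by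
    intro p hp
    simp only [mem_iUnion, Finset.mem_range] at hp
    obtain ⟨j, hj, hpj⟩ := hp
    refine ENNReal.ofReal_le_ofReal ?_
    have h1 := le_conj hR hu.nonneg p hxc
    -- The loss `3 m / 4` has three equal sources: the affine minorant misses `φ x`, the tilt along
    -- `e`, and the radius of the ball. If `u x < φ x - m`, a gap of `m / 4` remains.
    have h2 : conj (frontier Ω) φ p ≤ inner ℝ p x - φ x + 3 * m / 4 := by
      refine conj_le hF fun y hy => ?_
      have hyc := frontier_subset_closure hy
      have h3 := hl' y hyc
      have h4 : inner ℝ (p - p₀) (y - x) ≤ m / 2 := by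
        have e1 : p - p₀ = (3 * ρ * j) • e + (p - ctr j) := by simp only [ctr]; abel
        rw [e1, inner_add_left, real_inner_smul_left]
        have e2 : inner ℝ e (y - x) ≤ inner ℝ e (b - x) := by
          rw [inner_sub_right, inner_sub_right]
          linarith [he y hyc]
        have e3 : 0 ≤ (inner ℝ e (b - x) : ℝ) := by
          rw [inner_sub_right]; linarith [he x hxc]
        have e4 : 3 * ρ * j * inner ℝ e (y - x) ≤ 3 * ρ * k * inner ℝ e (b - x) := by
          have : (j : ℝ) ≤ k := by exact_mod_cast hj.le
          calc 3 * ρ * j * inner ℝ e (y - x) ≤ 3 * ρ * j * inner ℝ e (b - x) := by gcongr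
            _ ≤ _ := by gcongr
        have e5 : inner ℝ (p - ctr j) (y - x) ≤ ρ * R' := by
          refine (real_inner_le_norm _ _).trans ?_
          have n1 : ‖p - ctr j‖ ≤ ρ := by
            rw [← dist_eq_norm]; exact (Metric.mem_ball.1 hpj).le
          have n2 : ‖y - x‖ ≤ R' := by
            refine (norm_sub_le _ _).trans ?_
            linarith [hR y hyc, hR x hxc]
          gcongr
        have e6 : ρ * R' = m / 4 := by rw [hρ]; field_simp
        linarith
      rw [inner_sub_left, inner_sub_right, inner_sub_right] at h4
      linarith
    linarith
  have hdisj : Set.PairwiseDisjoint (↑(Finset.range k)) fun j => Metric.ball (ctr j) ρ := by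
    intro i _ j _ hij
    refine Metric.ball_disjoint_ball ?_
    have e1 : ctr i - ctr j = (3 * ρ * ((i : ℝ) - j)) • e := by
      simp only [ctr, add_sub_add_left_eq_sub, ← sub_smul]
      congr 1; ring
    rw [dist_eq_norm, e1, norm_smul, he1, mul_one, Real.norm_eq_abs, abs_mul,
      abs_of_pos (by positivity : 0 < 3 * ρ)]
    have : (1 : ℝ) ≤ |(i : ℝ) - j| := by
      have h0 : (i : ℤ) - j ≠ 0 := sub_ne_zero.2 (by exact_mod_cast hij)
      have := Int.one_le_abs h0
      exact_mod_cast this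
    nlinarith
  have hvol : volume (⋃ j ∈ Finset.range k, Metric.ball (ctr j) ρ) = k * V := by
    rw [measure_biUnion_finset hdisj fun j _ => measurableSet_ball]
    simp [Measure.addHaar_ball_center, hV]
  have hfin : k * (ENNReal.ofReal (m / 4) * V) ≤ ∫⁻ p, conjGap Ω φ u p := by
    calc k * (ENNReal.ofReal (m / 4) * V)
        = ENNReal.ofReal (m / 4) * volume (⋃ j ∈ Finset.range k, Metric.ball (ctr j) ρ) := by
          rw [hvol]; ring
      _ ≤ ENNReal.ofReal (m / 4) * volume {p | ENNReal.ofReal (m / 4) ≤ conjGap Ω φ u p} := by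
          gcongr
      _ ≤ _ := mul_meas_ge_le_lintegral (hu.measurable_conjGap hF hR) _
  exact absurd hk (not_lt.2 hfin)

end Boundary

/-! ### A convex minimizer, continuous up to the boundary. -/

section Regularity

variable {E : Type*} [NormedAddCommGroup E] [InnerProductSpace ℝ E] [FiniteDimensional ℝ E]
  [MeasurableSpace E] [BorelSpace E] {Ω : Set E} {φ g : E → ℝ} {q M L R : ℝ}

lemma Admissible.mono {w : E → ℝ} {M' : ℝ} (hw : Admissible Ω φ M w) (h : M ≤ M') :
    Admissible Ω φ M' w :=
  ⟨hw.aemeasurable, hw.eq_on_frontier, hw.nonneg, fun x hx => (hw.le x hx).trans h⟩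

lemma potential_lt_top (hΩ : MeasurableSet Ω) (hΩb : Bornology.IsBounded Ω) (hq : 0 ≤ q)
    (hgL : ∀ x ∈ Ω, g x ≤ L) (hg0 : ∀ x ∈ Ω, 0 ≤ g x) {w : E → ℝ}
    (hw0 : ∀ x ∈ Ω, 0 ≤ w x) (hwM : ∀ x ∈ Ω, w x ≤ M) : potential Ω g q w < ⊤ := by
  refine lt_of_le_of_lt (setLIntegral_mono' hΩ
    (g := fun _ => ENNReal.ofReal (L * primitive q M)) fun x hx => ?_) ?_
  · refine ENNReal.ofReal_le_ofReal ?_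
    have h1 := primitive_le_primitive hq (hw0 x hx) (hwM x hx)
    have h2 := primitive_nonneg hq (hw0 x hx)
    exact mul_le_mul (hgL x hx) h1 h2 ((hg0 x hx).trans (hgL x hx))
  · rw [setLIntegral_const]
    exact ENNReal.mul_lt_top ENNReal.ofReal_lt_top hΩb.measure_lt_top

/-- The energy has a minimizer that is convex and continuous up to the boundary. -/
theorem exists_convex_minimizer (hΩo : IsOpen Ω) (hΩc : Convex ℝ Ω)
    (hΩb : Bornology.IsBounded Ω) (hF : (frontier Ω).Nonempty)
    (hR : ∀ x ∈ closure Ω, ‖x‖ ≤ R) (hg : AEMeasurable g (volume.restrict Ω))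
    (hgL : ∀ x ∈ Ω, g x ≤ L) (hg0 : ∀ x ∈ Ω, 0 ≤ g x) (hq : 0 ≤ q)
    (hφc : ConvexOn ℝ (closure Ω) φ) (hφ : ContinuousOn φ (closure Ω))
    (hφ0 : ∀ x ∈ closure Ω, 0 ≤ φ x) (hφM : ∀ x ∈ closure Ω, φ x ≤ M) :
    ∃ u, ConvexOn ℝ Ω u ∧ ContinuousOn u (closure Ω) ∧ Admissible Ω φ M u ∧
      energy Ω g q φ u ≠ ⊤ ∧
      ∀ w, Admissible Ω φ (M + 1) w → energy Ω g q φ u ≤ energy Ω g q φ w := by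
  classical
  have hΩm := hΩo.measurableSet
  have hFc : ∀ x ∈ frontier Ω, x ∈ closure Ω := fun x hx => frontier_subset_closure hx
  have hFΩ : ∀ x ∈ frontier Ω, x ∉ Ω := fun x hx h => hx.2 (by rwa [hΩo.interior_eq])
  have hM0 : 0 ≤ M := by
    obtain ⟨b, hb⟩ := hF
    exact (hφ0 b (hFc b hb)).trans (hφM b (hFc b hb))
  -- The bound `M + 1` leaves room for upward variations: the convexified minimizer will satisfy `u
  -- ≤ M`.
  have hφA : Admissible Ω φ (M + 1) φ :=
    ⟨(hφ.mono subset_closure).aemeasurable hΩm, fun _ _ => rfl, hφ0,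
      fun x hx => (hφM x hx).trans (by linarith)⟩
  obtain ⟨W, hW, hWmin⟩ := exists_minimizer (q := q) hΩm hF hR hg hq hφA
  have hCne : (closure Ω).Nonempty := hF.mono frontier_subset_closure
  set C := conj (closure Ω) W with hC
  have hCW : ∀ x ∈ closure Ω, ∀ p, inner ℝ p x - C p ≤ W x := fun x hx p => by
    have := le_conj hR hW.nonneg p hx
    linarith
  have hbdd : ∀ x ∈ closure Ω, BddAbove (range fun p : E => inner ℝ p x - C p) := fun x hx =>
    ⟨W x, by rintro _ ⟨p, rfl⟩; exact hCW x hx p⟩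
  -- The biconjugate of `W` inside `Ω`, with the boundary values imposed by hand; their continuous
  -- attachment is proved below.
  let u : E → ℝ := fun x => if x ∈ Ω then ⨆ p : E, (inner ℝ p x - C p) else φ x
  have huΩ : ∀ x ∈ Ω, u x = ⨆ p : E, (inner ℝ p x - C p) := fun x hx => if_pos hx
  have huF : ∀ x ∈ frontier Ω, u x = φ x := fun x hx => if_neg (hFΩ x hx)
  have hule : ∀ x ∈ Ω, ∀ c : ℝ, (∀ p, inner ℝ p x - C p ≤ c) → u x ≤ c := fun x hx c h => by
    rw [huΩ x hx]; exact ciSup_le h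
  have hleu : ∀ x ∈ Ω, ∀ p, inner ℝ p x - C p ≤ u x := fun x hx p => by
    rw [huΩ x hx]; exact le_ciSup (hbdd x (subset_closure hx)) p
  have hconv : ConvexOn ℝ Ω u := by
    refine ⟨hΩc, fun x hx y hy a b ha hb hab => hule _ (hΩc hx hy ha hb hab) _ fun p => ?_⟩
    have h1 := mul_le_mul_of_nonneg_left (hleu x hx p) ha
    have h2 := mul_le_mul_of_nonneg_left (hleu y hy p) hb
    have h3 : C p = a * C p + b * C p := by rw [← add_mul, hab, one_mul]
    rw [inner_add_right, inner_smul_right, inner_smul_right, smul_eq_mul, smul_eq_mul]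
    linarith
  have hcontΩ : ContinuousOn u Ω := hconv.continuousOn hΩo
  have hcl : ∀ x ∈ closure Ω, x ∉ Ω → x ∈ frontier Ω := fun x hx h =>
    ⟨hx, by rwa [hΩo.interior_eq]⟩
  have huA : Admissible Ω φ M u := by
    refine ⟨hcontΩ.aemeasurable hΩm, huF, fun x hx => ?_, fun x hx => ?_⟩
    · by_cases hxΩ : x ∈ Ω
      · have h1 : C 0 ≤ 0 := conj_le hCne fun y hy => by
          rw [inner_zero_left]; linarith [hW.nonneg y hy]
        have := hleu x hxΩ 0
        rw [inner_zero_left] at this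
        linarith
      · rw [huF x (hcl x hx hxΩ)]; exact hφ0 x hx
    · by_cases hxΩ : x ∈ Ω
      · refine hule x hxΩ _ fun p => ?_
        obtain ⟨y, hy, hxy⟩ := exists_frontier_inner_le hΩo hΩb hF hx p
        have h1 := hCW y (hFc y hy) p
        rw [hW.eq_on_frontier y hy] at h1
        linarith [hφM y (hFc y hy)]
      · rw [huF x (hcl x hx hxΩ)]; exact hφM x hx
  have huW : ∀ x ∈ Ω, u x ≤ W x := fun x hx => hule x hx _ (hCW x (subset_closure hx))
  -- Biconjugation does not increase the conjugate and lowers the function itself, so neither part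
  -- of the energy grows.
  have hJu : energy Ω g q φ u ≤ energy Ω g q φ W := by
    refine add_le_add (lintegral_mono fun p => ENNReal.ofReal_le_ofReal ?_)
      (setLIntegral_mono' hΩm fun x hx => ENNReal.ofReal_le_ofReal ?_)
    · refine sub_le_sub_right (conj_le hCne fun x hx => ?_) _
      by_cases hxΩ : x ∈ Ω
      · linarith [hleu x hxΩ p]
      · rw [huF x (hcl x hx hxΩ), ← hW.eq_on_frontier x (hcl x hx hxΩ)]
        linarith [hCW x hx p]
    · exact mul_le_mul_of_nonneg_left (primitive_le_primitive hq
        (huA.nonneg x (subset_closure hx)) (huW x hx)) (hg0 x hx)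
  have hmin : ∀ w, Admissible Ω φ (M + 1) w → energy Ω g q φ u ≤ energy Ω g q φ w :=
    fun w hw => hJu.trans (hWmin w hw)
  have hfin : energy Ω g q φ u ≠ ⊤ := by
    -- The constant `M` inside `Ω` adds nothing to the conjugate of the boundary values: linear
    -- functions are dominated on the frontier, where `φ ≤ M`.
    let w₁ : E → ℝ := fun x => if x ∈ Ω then M else φ x
    have hw₁F : ∀ x ∈ frontier Ω, w₁ x = φ x := fun x hx => if_neg (hFΩ x hx)
    have hw₁Ω : ∀ x ∈ Ω, w₁ x = M := fun x hx => if_pos hx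
    have hw₁ : Admissible Ω φ (M + 1) w₁ := by
      refine ⟨?_, hw₁F, fun x hx => ?_, fun x hx => ?_⟩
      · exact (continuousOn_const.congr hw₁Ω).aemeasurable hΩm
      · by_cases hxΩ : x ∈ Ω
        · rwa [hw₁Ω x hxΩ]
        · rw [hw₁F x (hcl x hx hxΩ)]; exact hφ0 x hx
      · by_cases hxΩ : x ∈ Ω
        · rw [hw₁Ω x hxΩ]; linarith
        · rw [hw₁F x (hcl x hx hxΩ)]; linarith [hφM x hx]
    refine ((hmin w₁ hw₁).trans_lt ?_).ne
    have h1 : ∀ p, conjGap Ω φ w₁ p = 0 := fun p => by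
      refine ENNReal.ofReal_eq_zero.2 (sub_nonpos.2 (conj_le hCne fun x hx => ?_))
      have hle : ∀ y ∈ frontier Ω, inner ℝ p y - φ y ≤ conj (frontier Ω) φ p := fun y hy =>
        le_conj (fun z hz => hR z (hFc z hz)) (fun z hz => hφ0 z (hFc z hz)) p hy
      by_cases hxΩ : x ∈ Ω
      · obtain ⟨y, hy, hxy⟩ := exists_frontier_inner_le hΩo hΩb hF hx p
        rw [hw₁Ω x hxΩ]
        linarith [hle y hy, hφM y (hFc y hy)]
      · rw [hw₁F x (hcl x hx hxΩ)]
        exact hle x (hcl x hx hxΩ)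
    unfold energy
    simp only [h1, lintegral_zero, zero_add]
    exact potential_lt_top hΩm hΩb hq hgL hg0 (fun x hx => hw₁.nonneg x (subset_closure hx))
      (fun x hx => hw₁.le x (subset_closure hx))
  have hgap : ∫⁻ p, conjGap Ω φ u p ≠ ⊤ := ne_top_of_le_ne_top hfin le_self_add
  have hcont : ContinuousOn u (closure Ω) := by
    have hsplit : closure Ω = Ω ∪ frontier Ω := by
      ext x
      exact ⟨fun hx => (em (x ∈ Ω)).imp id (hcl x hx), fun hx => hx.elim (fun h =>
        subset_closure h) (hFc x)⟩
    intro b hb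
    by_cases hbΩ : b ∈ Ω
    · exact (hcontΩ.continuousAt (hΩo.mem_nhds hbΩ)).continuousWithinAt
    have hbF := hcl b hb hbΩ
    have h1 : ContinuousWithinAt u (frontier Ω) b :=
      ((hφ b hb).mono frontier_subset_closure).congr huF (huF b hbF)
    have h2 : ContinuousWithinAt u Ω b := by
      have hφb : Tendsto φ (𝓝[Ω] b) (𝓝 (φ b)) := (hφ b hb).mono subset_closure
      obtain ⟨c, hc⟩ : Ω.Nonempty := closure_nonempty_iff.1 hCne
      rw [ContinuousWithinAt, huF b hbF]
      refine tendsto_order.2 ⟨fun a ha => ?_, fun a ha => ?_⟩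
      · have hm : 0 < (φ b - a) / 2 := by linarith
        filter_upwards [eventually_sub_le_of_conjGap hΩo hΩc hR hφc hφ huA hgap hbF hm,
          hφb.eventually (lt_mem_nhds (show φ b - (φ b - a) / 2 < φ b by linarith))] with x e1 e2
        linarith
      · have hm : 0 < (a - φ b) / 2 := by linarith
        have := eventually_le_add_of_ray (u := u) (M := M + 1) hΩo hΩc hbF hc
          ((hφ b hb).mono frontier_subset_closure) (fun y hy r hr0 hr1 hmem => ?_) hm
        · filter_upwards [this] with x hx
          linarith
        -- Convexity up to the boundary is not yet known; the bound is obtained for each affine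
        -- function in the biconjugate, from its values at `y` and `c`.
        · refine hule _ hmem _ fun p => ?_
          have e1 := hCW y (hFc y hy) p
          have e2 := (hCW c (subset_closure hc) p).trans (hW.le c (subset_closure hc))
          rw [hW.eq_on_frontier y hy] at e1
          have e3 := mul_le_mul_of_nonneg_left e1 hr0
          have e4 := mul_le_mul_of_nonneg_left e2 (sub_nonneg.2 hr1)
          rw [inner_add_right, inner_smul_right, inner_smul_right]
          linarith
    rw [hsplit]
    exact h2.union h1
  exact ⟨u, hconv, hcont, huA, hfin, hmin⟩

end Regularity

/-! ### The Euler–Lagrange inequalities. -/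

section EulerLagrange

variable {n : ℕ} {Ω : Set (EuclideanSpace ℝ (Fin n))} {φ g u : EuclideanSpace ℝ (Fin n) → ℝ}
  {q M L R : ℝ}

/-- Continuity lets the supporting inequality pass from `Ω` to `closure Ω`. Thus `∂u(A)` consists of
the slopes whose conjugate is attained in `A`. -/
lemma mem_subdifferential_iff (hR : ∀ x ∈ closure Ω, ‖x‖ ≤ R) (hu0 : ∀ x ∈ closure Ω, 0 ≤ u x)
    (hu : ContinuousOn u (closure Ω)) {x p : EuclideanSpace ℝ (Fin n)} (hx : x ∈ Ω) :
    p ∈ subdifferential Ω u x ↔ inner ℝ p x - u x = conj (closure Ω) u p := by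
  have hxc : x ∈ closure Ω := subset_closure hx
  constructor
  · intro hp
    refine le_antisymm (le_conj hR hu0 p hxc) (conj_le ⟨x, hxc⟩ fun y hy => ?_)
    refine ContinuousWithinAt.closure_le (s := Ω) (f := fun y => (inner ℝ p y : ℝ) - u y)
      (g := fun _ => (inner ℝ p x : ℝ) - u x) hy ?_ continuousWithinAt_const ?_
    · exact (by fun_prop : Continuous fun y : EuclideanSpace ℝ (Fin n) =>
        (inner ℝ p y : ℝ)).continuousWithinAt.sub ((hu y hy).mono subset_closure)
    · intro z hz
      have := hp z hz
      rw [inner_sub_right] at this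
      linarith
  · intro hp y hy
    have := le_conj hR hu0 p (subset_closure hy)
    rw [inner_sub_right]
    linarith

lemma mongeAmpere_mono {A B : Set (EuclideanSpace ℝ (Fin n))} (h : A ⊆ B) :
    mongeAmpere Ω u A ≤ mongeAmpere Ω u B :=
  measure_mono (biUnion_subset_biUnion_left h)

lemma lintegral_restrict_indicator {α : Type*} [MeasurableSpace α] {μ : Measure α} {S U : Set α}
    (hU : MeasurableSet U) (hUS : U ⊆ S) (f : α → ENNReal) :
    ∫⁻ x in S, U.indicator f x ∂μ = ∫⁻ x in U, f x ∂μ := by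
  rw [lintegral_indicator hU, Measure.restrict_restrict hU, inter_eq_left.2 hUS]

/-- Testing minimality with `u + ε 1_U`. -/
lemma volume_conj_drop_le (hΩ : MeasurableSet Ω) (hF : (frontier Ω).Nonempty)
    (hR : ∀ x ∈ closure Ω, ‖x‖ ≤ R) (hg : AEMeasurable g (volume.restrict Ω))
    (hg0 : ∀ x ∈ Ω, 0 ≤ g x) (hq : 0 ≤ q) (hu : Admissible Ω φ M u)
    (hfin : energy Ω g q φ u ≠ ⊤)
    (hmin : ∀ w, Admissible Ω φ (M + 1) w → energy Ω g q φ u ≤ energy Ω g q φ w)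
    {U : Set (EuclideanSpace ℝ (Fin n))} (hU : MeasurableSet U) (hUΩ : U ⊆ Ω)
    (hUF : Disjoint U (frontier Ω)) {ε : ℝ} (hε : 0 < ε) (hε1 : ε ≤ 1) :
    volume {p | conj (closure Ω) (fun x => u x + U.indicator (fun _ => ε) x) p + ε ≤
      conj (closure Ω) u p} ≤ ∫⁻ x in U, ENNReal.ofReal (g x * (u x + ε) ^ q) := by
  set w : EuclideanSpace ℝ (Fin n) → ℝ := fun x => u x + U.indicator (fun _ => ε) x with hw
  have hi0 : ∀ x, 0 ≤ U.indicator (fun _ => ε) x := fun x => indicator_nonneg (fun _ _ => hε.le) x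
  have hi1 : ∀ x, U.indicator (fun _ => ε) x ≤ 1 := fun x =>
    indicator_le' (fun _ _ => hε1) (fun _ _ => zero_le_one) x
  have hwA : Admissible Ω φ (M + 1) w := by
    refine ⟨hu.aemeasurable.add (measurable_const.indicator hU).aemeasurable, fun x hx => ?_,
      fun x hx => add_nonneg (hu.nonneg x hx) (hi0 x), fun x hx => add_le_add (hu.le x hx) (hi1 x)⟩
    have : x ∉ U := fun h => disjoint_left.1 hUF h hx
    simp [hw, this, hu.eq_on_frontier x hx]
  have hC : (closure Ω).Nonempty := hF.mono frontier_subset_closure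
  have hanti : ∀ p, conj (closure Ω) w p ≤ conj (closure Ω) u p :=
    conj_anti hC hR hu.nonneg fun x _ => le_add_of_nonneg_right (hi0 x)
  -- Only slopes with the full drop `ε` are counted; the others merely do not increase.
  set Q := {p | conj (closure Ω) w p + ε ≤ conj (closure Ω) u p} with hQ
  have hQm : MeasurableSet Q :=
    measurableSet_le ((hwA.measurable_conj hF hR).add_const ε) (hu.measurable_conj hF hR)
  have hA : (∫⁻ p, conjGap Ω φ w p) + ENNReal.ofReal ε * volume Q ≤ ∫⁻ p, conjGap Ω φ u p := by
    rw [← lintegral_indicator_const hQm, ← lintegral_add_left (hwA.measurable_conjGap hF hR)]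
    refine lintegral_mono fun p => ?_
    by_cases hp : p ∈ Q
    · rw [indicator_of_mem hp, conjGap, ← ENNReal.ofReal_add
        (sub_nonneg.2 (hwA.conj_frontier_le hF hR p)) hε.le]
      have : conj (closure Ω) w p + ε ≤ conj (closure Ω) u p := hp
      exact ENNReal.ofReal_le_ofReal (by linarith)
    · rw [indicator_of_notMem hp, add_zero]
      exact ENNReal.ofReal_le_ofReal (sub_le_sub_right (hanti p) _)
  have hB : potential Ω g q w ≤ potential Ω g q u +
      ENNReal.ofReal ε * ∫⁻ x in U, ENNReal.ofReal (g x * (u x + ε) ^ q) := by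
    rw [← lintegral_const_mul' _ _ ENNReal.ofReal_ne_top, ← lintegral_restrict_indicator hU hUΩ,
      potential, potential, ← lintegral_add_left' (hu.aemeasurable_potential hg)]
    refine setLIntegral_mono' hΩ fun x hx => ?_
    have hux := hu.nonneg x (subset_closure hx)
    by_cases hxU : x ∈ U
    · rw [indicator_of_mem hxU, ← ENNReal.ofReal_mul hε.le, ← ENNReal.ofReal_add
        (mul_nonneg (hg0 x hx) (primitive_nonneg hq hux))
        (mul_nonneg hε.le (mul_nonneg (hg0 x hx) (by positivity)))]
      refine ENNReal.ofReal_le_ofReal ?_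
      have h1 := rpow_mul_sub_le_primitive_sub hq (a := u x + ε) (by positivity) hux
      have h2 := mul_le_mul_of_nonneg_left h1 (hg0 x hx)
      simp only [hw, indicator_of_mem hxU]
      linarith
    · simp [hw, hxU]
  have hDfin : (∫⁻ p, conjGap Ω φ w p) + potential Ω g q u ≠ ⊤ := by
    refine ne_top_of_le_ne_top hfin (add_le_add (le_trans le_self_add hA) le_rfl)
  have key : ENNReal.ofReal ε * volume Q ≤
      ENNReal.ofReal ε * ∫⁻ x in U, ENNReal.ofReal (g x * (u x + ε) ^ q) := by
    refine (ENNReal.add_le_add_iff_left hDfin).1 ?_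
    calc (∫⁻ p, conjGap Ω φ w p) + potential Ω g q u + ENNReal.ofReal ε * volume Q
        = (∫⁻ p, conjGap Ω φ w p) + ENNReal.ofReal ε * volume Q + potential Ω g q u := by ring
      _ ≤ energy Ω g q φ u := add_le_add hA le_rfl
      _ ≤ energy Ω g q φ w := hmin w hwA
      _ ≤ (∫⁻ p, conjGap Ω φ w p) + (potential Ω g q u + _) := add_le_add le_rfl hB
      _ = _ := by rw [add_assoc]
  exact (ENNReal.mul_le_mul_iff_right (by simpa using hε) ENNReal.ofReal_ne_top).1 key

/-- Testing minimality with `u - ε 1_K`. -/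
lemma lintegral_le_volume_conj_rise (hΩ : MeasurableSet Ω) (hF : (frontier Ω).Nonempty)
    (hR : ∀ x ∈ closure Ω, ‖x‖ ≤ R) (hg : AEMeasurable g (volume.restrict Ω))
    (hg0 : ∀ x ∈ Ω, 0 ≤ g x) (hq : 0 ≤ q) (hu : Admissible Ω φ M u)
    (hfin : energy Ω g q φ u ≠ ⊤)
    (hmin : ∀ w, Admissible Ω φ (M + 1) w → energy Ω g q φ u ≤ energy Ω g q φ w)
    {K : Set (EuclideanSpace ℝ (Fin n))} (hK : MeasurableSet K) (hKΩ : K ⊆ Ω)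
    (hKF : Disjoint K (frontier Ω)) {ε : ℝ} (hε : 0 < ε) (hεu : ∀ x ∈ K, ε ≤ u x) :
    ∫⁻ x in K, ENNReal.ofReal (g x * (u x - ε) ^ q) ≤ volume {p | conj (closure Ω) u p <
      conj (closure Ω) (fun x => u x - K.indicator (fun _ => ε) x) p} := by
  set w : EuclideanSpace ℝ (Fin n) → ℝ := fun x => u x - K.indicator (fun _ => ε) x with hw
  have hi0 : ∀ x, 0 ≤ K.indicator (fun _ => ε) x := fun x => indicator_nonneg (fun _ _ => hε.le) x
  have hi1 : ∀ x, K.indicator (fun _ => ε) x ≤ ε := fun x =>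
    indicator_le' (fun _ _ => le_rfl) (fun _ _ => hε.le) x
  have hwA : Admissible Ω φ (M + 1) w := by
    refine ⟨hu.aemeasurable.sub (measurable_const.indicator hK).aemeasurable, fun x hx => ?_,
      fun x hx => ?_, fun x hx => ?_⟩
    · have : x ∉ K := fun h => disjoint_left.1 hKF h hx
      simp [hw, this, hu.eq_on_frontier x hx]
    · by_cases hxK : x ∈ K
      · simp [hw, hxK, hεu x hxK]
      · simp [hw, hxK, hu.nonneg x hx]
    · simp only [hw]
      linarith [hi0 x, hu.le x hx]
  have hC : (closure Ω).Nonempty := hF.mono frontier_subset_closure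
  have hadd : ∀ p, conj (closure Ω) w p ≤ conj (closure Ω) u p + ε :=
    conj_le_conj_add hC hR hu.nonneg fun x _ => by simp only [hw]; linarith [hi1 x]
  set P := {p | conj (closure Ω) u p < conj (closure Ω) w p} with hP
  have hPm : MeasurableSet P :=
    measurableSet_lt (hu.measurable_conj hF hR) (hwA.measurable_conj hF hR)
  have hA : ∫⁻ p, conjGap Ω φ w p ≤ (∫⁻ p, conjGap Ω φ u p) + ENNReal.ofReal ε * volume P := by
    rw [← lintegral_indicator_const hPm, ← lintegral_add_left (hu.measurable_conjGap hF hR)]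
    refine lintegral_mono fun p => ?_
    by_cases hp : p ∈ P
    · rw [indicator_of_mem hp, conjGap, conjGap, ← ENNReal.ofReal_add
        (sub_nonneg.2 (hu.conj_frontier_le hF hR p)) hε.le]
      exact ENNReal.ofReal_le_ofReal (by linarith [hadd p])
    · rw [indicator_of_notMem hp, add_zero]
      exact ENNReal.ofReal_le_ofReal (sub_le_sub_right (not_lt.1 hp) _)
  have hB : potential Ω g q w +
      ENNReal.ofReal ε * ∫⁻ x in K, ENNReal.ofReal (g x * (u x - ε) ^ q) ≤ potential Ω g q u := by
    rw [← lintegral_const_mul' _ _ ENNReal.ofReal_ne_top, ← lintegral_restrict_indicator hK hKΩ,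
      potential, potential, ← lintegral_add_left' (hwA.aemeasurable_potential hg)]
    refine setLIntegral_mono' hΩ fun x hx => ?_
    have hux := hu.nonneg x (subset_closure hx)
    by_cases hxK : x ∈ K
    · have hue : 0 ≤ u x - ε := sub_nonneg.2 (hεu x hxK)
      simp only [hw, indicator_of_mem hxK]
      rw [← ENNReal.ofReal_mul hε.le, ← ENNReal.ofReal_add
        (mul_nonneg (hg0 x hx) (primitive_nonneg hq hue))
        (mul_nonneg hε.le (mul_nonneg (hg0 x hx) (by positivity)))]
      refine ENNReal.ofReal_le_ofReal ?_
      have h1 := rpow_mul_sub_le_primitive_sub hq hue hux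
      have h2 := mul_le_mul_of_nonneg_left h1 (hg0 x hx)
      linarith
    · simp [hw, hxK]
  have hpot : potential Ω g q w ≠ ⊤ :=
    ne_top_of_le_ne_top hfin ((le_self_add.trans hB).trans le_add_self)
  have hgap : ∫⁻ p, conjGap Ω φ u p ≠ ⊤ := ne_top_of_le_ne_top hfin le_self_add
  have key : ENNReal.ofReal ε * ∫⁻ x in K, ENNReal.ofReal (g x * (u x - ε) ^ q) ≤
      ENNReal.ofReal ε * volume P := by
    refine (ENNReal.add_le_add_iff_left (ENNReal.add_ne_top.2 ⟨hgap, hpot⟩)).1 ?_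
    calc (∫⁻ p, conjGap Ω φ u p) + potential Ω g q w +
          ENNReal.ofReal ε * ∫⁻ x in K, ENNReal.ofReal (g x * (u x - ε) ^ q)
        ≤ energy Ω g q φ u := by rw [add_assoc]; exact add_le_add le_rfl hB
      _ ≤ energy Ω g q φ w := hmin w hwA
      _ ≤ (∫⁻ p, conjGap Ω φ u p) + ENNReal.ofReal ε * volume P + potential Ω g q w :=
          add_le_add hA le_rfl
      _ = _ := by ring
  exact (ENNReal.mul_le_mul_iff_right (by simpa using hε) ENNReal.ofReal_ne_top).1 key

/-- A minimizer satisfies `det D² u ≤ g u ^ q` on open sets. -/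
lemma mongeAmpere_le_of_isOpen (hΩo : IsOpen Ω) (hΩb : Bornology.IsBounded Ω)
    (hF : (frontier Ω).Nonempty)
    (hR : ∀ x ∈ closure Ω, ‖x‖ ≤ R) (hg : AEMeasurable g (volume.restrict Ω))
    (hg0 : ∀ x ∈ Ω, 0 ≤ g x) (hgL : ∀ x ∈ Ω, g x ≤ L) (hq : 0 ≤ q) (hu : Admissible Ω φ M u)
    (huc : ContinuousOn u (closure Ω)) (hfin : energy Ω g q φ u ≠ ⊤)
    (hmin : ∀ w, Admissible Ω φ (M + 1) w → energy Ω g q φ u ≤ energy Ω g q φ w)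
    {U : Set (EuclideanSpace ℝ (Fin n))} (hU : IsOpen U) (hUΩ : U ⊆ Ω) :
    mongeAmpere Ω u U ≤ ∫⁻ x in U, ENNReal.ofReal (g x * u x ^ q) := by
  have hUF : Disjoint U (frontier Ω) := disjoint_left.2 fun x hx hxF =>
    hxF.2 (by rw [hΩo.interior_eq]; exact hUΩ hx)
  have hC : (closure Ω).Nonempty := hF.mono frontier_subset_closure
  let ε : ℕ → ℝ := fun j => 1 / ((j : ℝ) + 1)
  have hε0 : ∀ j, 0 < ε j := fun j => Nat.one_div_pos_of_nat
  have hε1 : ∀ j, ε j ≤ 1 := fun j => by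
    have : (0 : ℝ) ≤ j := j.cast_nonneg
    exact (div_le_one (by positivity)).2 (by linarith)
  have hεt : Tendsto ε atTop (𝓝 0) := tendsto_one_div_add_atTop_nhds_zero_nat
  let Q : ℕ → Set (EuclideanSpace ℝ (Fin n)) := fun j =>
    {p | conj (closure Ω) (fun x => u x + U.indicator (fun _ => ε j) x) p + ε j ≤
      conj (closure Ω) u p}
  have hQ : ∀ j, volume (Q j) ≤ ∫⁻ x in U, ENNReal.ofReal (g x * (u x + ε j) ^ q) := fun j =>
    volume_conj_drop_le hΩo.measurableSet hF hR hg hg0 hq hu hfin hmin hU.measurableSet hUΩ hUF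
      (hε0 j) (hε1 j)
  have hlim : Tendsto (fun j => ∫⁻ x in U, ENNReal.ofReal (g x * (u x + ε j) ^ q)) atTop
      (𝓝 (∫⁻ x in U, ENNReal.ofReal (g x * u x ^ q))) := by
    refine tendsto_lintegral_of_dominated_convergence'
      (fun _ => ENNReal.ofReal (L * (M + 1) ^ q)) (fun j => ?_) (fun j => ?_) ?_ ?_
    · have h1 := (hg.mono_measure (Measure.restrict_mono_set volume hUΩ))
      have h2 := (hu.aemeasurable.mono_measure (Measure.restrict_mono_set volume hUΩ))
      exact (h1.mul ((h2.add_const _).pow_const _)).ennreal_ofReal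
    · filter_upwards [ae_restrict_mem hU.measurableSet] with x hx
      have hx' := hUΩ hx
      have h0 := hu.nonneg x (subset_closure hx')
      have h1 := hε0 j
      refine ENNReal.ofReal_le_ofReal (mul_le_mul (hgL x hx') ?_ (by positivity)
        ((hg0 x hx').trans (hgL x hx')))
      exact Real.rpow_le_rpow (by positivity) (add_le_add (hu.le x (subset_closure hx')) (hε1 j)) hq
    · rw [setLIntegral_const]
      exact (ENNReal.mul_lt_top ENNReal.ofReal_lt_top (hΩb.subset hUΩ).measure_lt_top).ne
    · refine Eventually.of_forall fun x => ENNReal.tendsto_ofReal (tendsto_const_nhds.mul ?_)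
      have : Tendsto (fun j => u x + ε j) atTop (𝓝 (u x)) := by
        simpa using tendsto_const_nhds.add hεt
      exact this.rpow_const (Or.inr hq)
  set N := {p | ∃ x ∈ closure Ω, ∃ y ∈ closure Ω, x ≠ y ∧
    inner ℝ p x - u x = conj (closure Ω) u p ∧ inner ℝ p y - u y = conj (closure Ω) u p} with hN
  have hN0 : volume N = 0 := volume_setOf_two_maximizers hR hu.nonneg
  let S : ℕ → Set (EuclideanSpace ℝ (Fin n)) := fun k => ⋂ j ≥ k, Q j
  have hSmono : Monotone S := fun k l hkl p hp => by
    simp only [S, mem_iInter] at hp ⊢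
    exact fun j hj => hp j (hkl.trans hj)
  have hsub : (⋃ x ∈ U, subdifferential Ω u x) ⊆ N ∪ ⋃ k, S k := by
    intro p hp
    simp only [mem_iUnion] at hp
    obtain ⟨x, hxU, hpx⟩ := hp
    have hxΩ := hUΩ hxU
    rw [mem_subdifferential_iff hR hu.nonneg huc hxΩ] at hpx
    by_cases hpN : p ∈ N
    · exact Or.inl hpN
    refine Or.inr ?_
    -- For a slope with its unique maximizer in `U`, compactness of `closure Ω \ U` leaves a strict
    -- gap outside `U`. Once `ε j` is below it, raising `u` by `ε j` on `U` lowers the conjugate by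
    -- the full amount.
    obtain ⟨s, hs, hsmax⟩ : ∃ s < conj (closure Ω) u p, ∀ y ∈ closure Ω \ U,
        inner ℝ p y - u y ≤ s := by
      have hKc : IsCompact (closure Ω \ U) := hΩb.isCompact_closure.diff hU
      rcases (closure Ω \ U).eq_empty_or_nonempty with he | hne
      · exact ⟨conj (closure Ω) u p - 1, by linarith, by simp [he]⟩
      · obtain ⟨z, hz, hzmax⟩ := hKc.exists_isMaxOn hne
          (f := fun y => (inner ℝ p y : ℝ) - u y)
          ((by fun_prop : Continuous fun y : EuclideanSpace ℝ (Fin n) =>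
            (inner ℝ p y : ℝ)).continuousOn.sub (huc.mono sdiff_subset))
        refine ⟨inner ℝ p z - u z, lt_of_le_of_ne (le_conj hR hu.nonneg p hz.1) fun h => ?_,
          fun y hy => hzmax hy⟩
        exact hpN ⟨x, subset_closure hxΩ, z, hz.1, fun hxz => hz.2 (hxz ▸ hxU), hpx, h⟩
    have hev : ∀ᶠ j in atTop, ε j < conj (closure Ω) u p - s :=
      hεt.eventually (gt_mem_nhds (by linarith))
    obtain ⟨k, hk⟩ := eventually_atTop.1 hev
    refine mem_iUnion.2 ⟨k, ?_⟩
    simp only [S, mem_iInter]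
    intro j hj
    have hjs := hk j hj
    have : conj (closure Ω) (fun x => u x + U.indicator (fun _ => ε j) x) p ≤
        conj (closure Ω) u p - ε j := by
      refine conj_le hC fun y hy => ?_
      by_cases hyU : y ∈ U
      · simp only [indicator_of_mem hyU]
        linarith [le_conj hR hu.nonneg p hy]
      · simp only [indicator_of_notMem hyU]
        linarith [hsmax y ⟨hy, hyU⟩]
    change _ + ε j ≤ _
    linarith
  calc mongeAmpere Ω u U ≤ volume (N ∪ ⋃ k, S k) := measure_mono hsub
    _ ≤ volume N + volume (⋃ k, S k) := measure_union_le _ _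
    _ = ⨆ k, volume (S k) := by rw [hN0, zero_add, hSmono.measure_iUnion]
    _ ≤ _ := by
      refine iSup_le fun k => ge_of_tendsto hlim ?_
      filter_upwards [eventually_ge_atTop k] with j hj
      exact (measure_mono (iInter₂_subset j hj)).trans (hQ j)

/-- A minimizer satisfies `det D² u ≥ g u ^ q` on compact subsets of `{u > 0}`. -/
lemma le_mongeAmpere_of_isCompact (hΩo : IsOpen Ω) (hF : (frontier Ω).Nonempty)
    (hR : ∀ x ∈ closure Ω, ‖x‖ ≤ R) (hg : AEMeasurable g (volume.restrict Ω))
    (hg0 : ∀ x ∈ Ω, 0 ≤ g x) (hq : 0 ≤ q) (hu : Admissible Ω φ M u)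
    (huc : ContinuousOn u (closure Ω)) (hfin : energy Ω g q φ u ≠ ⊤)
    (hmin : ∀ w, Admissible Ω φ (M + 1) w → energy Ω g q φ u ≤ energy Ω g q φ w)
    {K : Set (EuclideanSpace ℝ (Fin n))} (hK : IsCompact K) (hKΩ : K ⊆ Ω)
    (hKu : ∀ x ∈ K, 0 < u x) :
    ∫⁻ x in K, ENNReal.ofReal (g x * u x ^ q) ≤ mongeAmpere Ω u K := by
  rcases K.eq_empty_or_nonempty with rfl | hKne
  · simp
  have hKF : Disjoint K (frontier Ω) := disjoint_left.2 fun x hx hxF =>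
    hxF.2 (by rw [hΩo.interior_eq]; exact hKΩ hx)
  have hC : (closure Ω).Nonempty := hF.mono frontier_subset_closure
  have hKc : K ⊆ closure Ω := hKΩ.trans subset_closure
  obtain ⟨x₀, hx₀, hx₀min⟩ := hK.exists_isMinOn hKne (huc.mono hKc)
  -- The first bound keeps `u - ε j` nonnegative on `K`, the second gives the numerator `M + 1` in
  -- the bound on slopes.
  set δ := min (u x₀) 1 with hδ
  have hδ0 : 0 < δ := lt_min (hKu x₀ hx₀) one_pos
  let ε : ℕ → ℝ := fun j => δ * (1 / ((j : ℝ) + 1))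
  have hε0 : ∀ j, 0 < ε j := fun j => mul_pos hδ0 Nat.one_div_pos_of_nat
  have hεanti : Antitone ε := fun i j hij =>
    mul_le_mul_of_nonneg_left (Nat.one_div_le_one_div hij) hδ0.le
  have hεδ : ∀ j, ε j ≤ δ := fun j => by
    have := hεanti (Nat.zero_le j)
    simpa [ε] using this
  have hεt : Tendsto ε atTop (𝓝 0) := by
    simpa [ε] using tendsto_one_div_add_atTop_nhds_zero_nat.const_mul δ
  have hεu : ∀ j, ∀ x ∈ K, ε j ≤ u x := fun j x hx =>
    ((hεδ j).trans (min_le_left _ _)).trans (hx₀min hx)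
  let w : ℕ → EuclideanSpace ℝ (Fin n) → ℝ := fun j x => u x - K.indicator (fun _ => ε j) x
  let P : ℕ → Set (EuclideanSpace ℝ (Fin n)) := fun j =>
    {p | conj (closure Ω) u p < conj (closure Ω) (w j) p}
  have hw0 : ∀ j, ∀ x ∈ closure Ω, 0 ≤ w j x := fun j x hx => by
    by_cases hxK : x ∈ K
    · simp [w, hxK, hεu j x hxK]
    · simp [w, hxK, hu.nonneg x hx]
  have hP : ∀ j, ∫⁻ x in K, ENNReal.ofReal (g x * (u x - ε j) ^ q) ≤ volume (P j) := fun j =>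
    lintegral_le_volume_conj_rise hΩo.measurableSet hF hR hg hg0 hq hu hfin hmin
      hK.measurableSet hKΩ hKF (hε0 j) (hεu j)
  have hPanti : Antitone P := by
    intro i j hij p hp
    refine lt_of_lt_of_le (show conj (closure Ω) u p < conj (closure Ω) (w j) p from hp) ?_
    refine conj_anti hC hR (hw0 i) (fun x _ => ?_) p
    by_cases hxK : x ∈ K
    · simp only [w, indicator_of_mem hxK]
      linarith [hεanti hij]
    · simp [w, hxK]
  have hPm : ∀ j, NullMeasurableSet (P j) volume := fun j =>
    (measurableSet_lt (hu.measurable_conj hF hR)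
      (measurable_conj hC hR (hw0 j))).nullMeasurableSet
  have hPex : ∀ j, ∀ p ∈ P j, ∃ x ∈ K, conj (closure Ω) u p < inner ℝ p x - u x + ε j := by
    intro j p hp
    by_contra! hcon
    refine absurd (show conj (closure Ω) u p < conj (closure Ω) (w j) p from hp) (not_lt.2 ?_)
    refine conj_le hC fun x hx => ?_
    by_cases hxK : x ∈ K
    · simp only [w, indicator_of_mem hxK]
      linarith [hcon x hxK]
    · simp only [w, indicator_of_notMem hxK]
      linarith [le_conj hR hu.nonneg p hx]
  obtain ⟨r, hr0, hr⟩ := hK.exists_cthickening_subset_open hΩo hKΩ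
  -- Slopes nearly attained on `K`, which has distance to `∂Ω`, are bounded; this gives the finite
  -- measure needed for continuity from above.
  have hPb : P 0 ⊆ Metric.closedBall 0 ((M + 1) / r) := by
    intro p hp
    obtain ⟨x, hxK, hx⟩ := hPex 0 p hp
    rw [mem_closedBall_zero_iff, le_div_iff₀ hr0]
    by_cases hp0 : p = 0
    · have := (hu.nonneg x (hKc hxK)).trans (hu.le x (hKc hxK))
      rw [hp0, norm_zero, zero_mul]
      linarith
    have hpn : 0 < ‖p‖ := norm_pos_iff.2 hp0
    set y := x + (r / ‖p‖) • p with hy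
    have hyΩ : y ∈ closure Ω := subset_closure (hr (Metric.mem_cthickening_of_dist_le y x r K hxK
      (by rw [hy, dist_eq_norm, add_sub_cancel_left, norm_smul, Real.norm_eq_abs,
            abs_of_pos (by positivity), div_mul_cancel₀ _ hpn.ne'])))
    have h1 := le_conj hR hu.nonneg p hyΩ
    have h2 : inner ℝ p y = inner ℝ p x + ‖p‖ * r := by
      rw [hy, inner_add_right, inner_smul_right, real_inner_self_eq_norm_sq]
      field_simp
    have h3 := (hεδ 0).trans (min_le_right _ _)
    linarith [hu.le y hyΩ, hu.nonneg x (hKc hxK)]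
  have hlimP : Tendsto (fun j => volume (P j)) atTop (𝓝 (volume (⋂ j, P j))) :=
    tendsto_measure_iInter_atTop hPm hPanti
      ⟨0, ((measure_mono hPb).trans_lt measure_closedBall_lt_top).ne⟩
  -- Such a slope is attained on `K` up to every `ε j`, so its maximum over the compact `K` equals
  -- the conjugate.
  have hsub : ⋂ j, P j ⊆ ⋃ x ∈ K, subdifferential Ω u x := by
    intro p hp
    obtain ⟨z, hz, hzmax⟩ := hK.exists_isMaxOn hKne
      (f := fun y => (inner ℝ p y : ℝ) - u y)
      ((by fun_prop : Continuous fun y : EuclideanSpace ℝ (Fin n) =>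
        (inner ℝ p y : ℝ)).continuousOn.sub (huc.mono hKc))
    refine mem_iUnion₂.2 ⟨z, hz, ?_⟩
    rw [mem_subdifferential_iff hR hu.nonneg huc (hKΩ hz)]
    refine le_antisymm (le_conj hR hu.nonneg p (hKc hz)) ?_
    have hl : Tendsto (fun j => (inner ℝ p z : ℝ) - u z + ε j) atTop
        (𝓝 (inner ℝ p z - u z)) := by
      simpa using tendsto_const_nhds.add hεt
    refine ge_of_tendsto' hl fun j => ?_
    obtain ⟨x, hxK, hx⟩ := hPex j p (mem_iInter.1 hp j)
    have : inner ℝ p x - u x ≤ inner ℝ p z - u z := hzmax hxK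
    linarith
  calc ∫⁻ x in K, ENNReal.ofReal (g x * u x ^ q)
      = ∫⁻ x in K, liminf (fun j => ENNReal.ofReal (g x * (u x - ε j) ^ q)) atTop := by
        refine lintegral_congr fun x => (Tendsto.liminf_eq ?_).symm
        refine ENNReal.tendsto_ofReal (tendsto_const_nhds.mul ?_)
        have : Tendsto (fun j => u x - ε j) atTop (𝓝 (u x)) := by
          simpa using tendsto_const_nhds.sub hεt
        exact this.rpow_const (Or.inr hq)
    _ ≤ liminf (fun j => ∫⁻ x in K, ENNReal.ofReal (g x * (u x - ε j) ^ q)) atTop := by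
        refine lintegral_liminf_le' fun j => ?_
        have h1 := (hg.mono_measure (Measure.restrict_mono_set volume hKΩ))
        have h2 := (hu.aemeasurable.mono_measure (Measure.restrict_mono_set volume hKΩ))
        exact (h1.mul ((h2.sub_const _).pow_const _)).ennreal_ofReal
    _ ≤ liminf (fun j => volume (P j)) atTop := liminf_le_liminf (Eventually.of_forall hP)
    _ = volume (⋂ j, P j) := hlimP.liminf_eq
    _ ≤ mongeAmpere Ω u K := measure_mono hsub

end EulerLagrange

/-! ### The Dirichlet problem. -/

section Existence

variable {n : ℕ} {Ω : Set (EuclideanSpace ℝ (Fin n))}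

/-- At a point near which `u` is affine, the subdifferential is the slope. -/
lemma subdifferential_subset_of_eventuallyEq {u : EuclideanSpace ℝ (Fin n) → ℝ}
    {x p : EuclideanSpace ℝ (Fin n)} {c : ℝ}
    (h : ∀ᶠ y in 𝓝 x, y ∈ Ω ∧ u y = inner ℝ p y + c) : subdifferential Ω u x ⊆ {p} := by
  intro p' hp'
  rw [mem_singleton_iff, ← sub_eq_zero]
  by_contra hne
  have hc : Tendsto (fun t : ℝ => x + t • (p' - p)) (𝓝[>] 0) (𝓝 x) := by
    have : Tendsto (fun t : ℝ => x + t • (p' - p)) (𝓝 0) (𝓝 (x + (0 : ℝ) • (p' - p))) :=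
      Continuous.tendsto (by fun_prop) 0
    rw [zero_smul, add_zero] at this
    exact this.mono_left nhdsWithin_le_nhds
  obtain ⟨t, ⟨htΩ, ht⟩, ht0⟩ := ((hc.eventually h).and self_mem_nhdsWithin).exists
  have h1 := hp' _ htΩ
  rw [ht, h.self_of_nhds.2, add_sub_cancel_left, inner_add_right, inner_smul_right,
    inner_smul_right] at h1
  have h2 : inner ℝ p' (p' - p) - inner ℝ p (p' - p) = ‖p' - p‖ ^ 2 := by
    rw [← inner_sub_left, real_inner_self_eq_norm_sq]
  have h3 : 0 < t * ‖p' - p‖ ^ 2 := mul_pos ht0 (pow_pos (norm_pos_iff.2 hne) 2)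
  rw [← h2] at h3
  linarith

lemma nontrivial_euclideanSpace (hn : 0 < n) : Nontrivial (EuclideanSpace ℝ (Fin n)) := by
  have : Nonempty (Fin n) := ⟨⟨0, hn⟩⟩
  infer_instance

lemma frontier_nonempty_of_isBounded (hn : 0 < n) (hΩb : Bornology.IsBounded Ω)
    (hΩne : Ω.Nonempty) : (frontier Ω).Nonempty := by
  have := nontrivial_euclideanSpace hn
  refine nonempty_frontier_iff.2 ⟨hΩne, fun h => ?_⟩
  have : NoncompactSpace (EuclideanSpace ℝ (Fin n)) := NormedSpace.noncompactSpace ℝ _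
  have hc := hΩb.isCompact_closure
  rw [h, closure_univ] at hc
  exact noncompact_univ _ hc

/-- Solvability of the Dirichlet problem with convex boundary data. -/
theorem exists_isSolution (hn : 0 < n) {q : ℝ} (hq : 0 ≤ q) (hΩo : IsOpen Ω) (hΩc : Convex ℝ Ω)
    (hΩb : Bornology.IsBounded Ω) (hΩne : Ω.Nonempty) {g : EuclideanSpace ℝ (Fin n) → ℝ}
    (hg : AEMeasurable g (volume.restrict Ω)) (hg0 : ∀ x ∈ Ω, 0 ≤ g x) {L : ℝ}
    (hgL : ∀ x ∈ Ω, g x ≤ L) {φ : EuclideanSpace ℝ (Fin n) → ℝ}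
    (hφc : ConvexOn ℝ (closure Ω) φ) (hφ : ContinuousOn φ (closure Ω))
    (hφ0 : ∀ x ∈ closure Ω, 0 ≤ φ x) :
    ∃ u, IsSolution Ω g q u ∧ ∀ x ∈ frontier Ω, u x = φ x := by
  have hnt := nontrivial_euclideanSpace hn
  have hF := frontier_nonempty_of_isBounded hn hΩb hΩne
  obtain ⟨R, hR⟩ := hΩb.closure.exists_norm_le
  obtain ⟨M, hM⟩ := (hΩb.isCompact_closure.image_of_continuousOn hφ).bddAbove
  have hφM : ∀ x ∈ closure Ω, φ x ≤ M := fun x hx => hM (mem_image_of_mem φ hx)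
  have hΩm := hΩo.measurableSet
  obtain ⟨u, hconv, huc, hu, hfin, hmin⟩ :=
    exists_convex_minimizer (q := q) hΩo hΩc hΩb hF hR hg hgL hg0 hq hφc hφ hφ0 hφM
  refine ⟨u, ⟨hconv, huc, fun x hx => hu.nonneg x (subset_closure hx), fun A hA hAΩ => ?_⟩,
    hu.eq_on_frontier⟩
  let f : EuclideanSpace ℝ (Fin n) → ENNReal := fun x => ENNReal.ofReal (g x * u x ^ q)
  -- Finite, so outer and inner regularity carry the bounds from open and compact sets to Borel
  -- sets.
  set ν := (volume.restrict Ω).withDensity f with hν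
  have hνA : ∀ B, MeasurableSet B → B ⊆ Ω → ν B = ∫⁻ x in B, f x := fun B hB hBΩ => by
    rw [hν, withDensity_apply _ hB, Measure.restrict_restrict hB, inter_eq_left.2 hBΩ]
  have hνfin : IsFiniteMeasure ν := by
    refine isFiniteMeasure_withDensity (ne_top_of_le_ne_top ?_ (setLIntegral_mono' hΩm
      (g := fun _ => ENNReal.ofReal (L * M ^ q)) fun x hx => ?_))
    · rw [setLIntegral_const]
      exact (ENNReal.mul_lt_top ENNReal.ofReal_lt_top hΩb.measure_lt_top).ne
    · have h0 := hu.nonneg x (subset_closure hx)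
      exact ENNReal.ofReal_le_ofReal (mul_le_mul (hgL x hx)
        (Real.rpow_le_rpow h0 (hu.le x (subset_closure hx)) hq) (by positivity)
        ((hg0 x hx).trans (hgL x hx)))
  have hνac : ν ≪ volume :=
    (withDensity_absolutelyContinuous _ _).trans Measure.restrict_le_self.absolutelyContinuous
  have hupper : ∀ B ⊆ Ω, mongeAmpere Ω u B ≤ ν B := by
    intro B hB
    rw [B.measure_eq_iInf_isOpen ν]
    refine le_iInf₂ fun U hBU => le_iInf fun hU => ?_
    calc mongeAmpere Ω u B ≤ mongeAmpere Ω u (U ∩ Ω) := mongeAmpere_mono (subset_inter hBU hB)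
      _ ≤ ∫⁻ x in U ∩ Ω, f x := mongeAmpere_le_of_isOpen hΩo hΩb hF hR hg hg0 hgL hq hu huc hfin
          hmin (hU.inter hΩo) inter_subset_right
      _ = ν (U ∩ Ω) := (hνA _ (hU.inter hΩo).measurableSet inter_subset_right).symm
      _ ≤ ν U := measure_mono inter_subset_left
  set D := {x | x ∈ Ω ∧ 0 < u x} with hD
  have hDo : IsOpen D :=
    (huc.mono subset_closure).isOpen_inter_preimage hΩo (isOpen_Ioi (a := (0 : ℝ)))
  have hAD : MeasurableSet (A ∩ D) := hA.inter hDo.measurableSet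
  have hADΩ : A ∩ D ⊆ Ω := inter_subset_left.trans hAΩ
  have hlower : ν (A ∩ D) ≤ mongeAmpere Ω u A := by
    rw [hAD.measure_eq_iSup_isCompact_of_ne_top (measure_ne_top ν _)]
    refine iSup₂_le fun K hKA => iSup_le fun hK => ?_
    rw [hνA K hK.measurableSet (hKA.trans hADΩ)]
    exact (le_mongeAmpere_of_isCompact hΩo hF hR hg hg0 hq hu huc hfin hmin hK (hKA.trans hADΩ)
      fun x hx => (hKA hx).2.2).trans (mongeAmpere_mono (hKA.trans inter_subset_left))
  -- The bound by `ν` alone does not suffice on the zero set: for `q = 0` its density there is `g`,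
  -- as `0 ^ 0 = 1`. But `Z` is convex, so its frontier is null, and on its interior the only slope
  -- is `0`.
  set Z := {x | x ∈ Ω ∧ u x ≤ 0} with hZ
  have hZc : Convex ℝ Z := hconv.convex_le 0
  have hMAZ : mongeAmpere Ω u Z ≤ 0 := by
    have hsplit : Z ⊆ (Z ∩ interior Z) ∪ (Z ∩ frontier Z) := fun x hx => by
      by_cases hxi : x ∈ interior Z
      · exact Or.inl ⟨hx, hxi⟩
      · exact Or.inr ⟨hx, subset_closure hx, hxi⟩
    have h1 : (⋃ x ∈ Z ∩ interior Z, subdifferential Ω u x) ⊆ {0} := by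
      refine iUnion₂_subset fun x hx => subdifferential_subset_of_eventuallyEq (c := 0) ?_
      filter_upwards [isOpen_interior.mem_nhds hx.2] with y hy
      have hyZ := interior_subset hy
      exact ⟨hyZ.1, by
        rw [inner_zero_left, add_zero]
        exact le_antisymm hyZ.2 (hu.nonneg y (subset_closure hyZ.1))⟩
    have h2 : mongeAmpere Ω u (Z ∩ frontier Z) = 0 := by
      refine le_antisymm ((hupper _ fun x hx => hx.1.1).trans ?_) zero_le
      refine (measure_mono inter_subset_right).trans (le_of_eq (hνac ?_))
      exact hZc.addHaar_frontier volume
    calc mongeAmpere Ω u Z ≤ mongeAmpere Ω u ((Z ∩ interior Z) ∪ (Z ∩ frontier Z)) :=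
          mongeAmpere_mono hsplit
      _ ≤ mongeAmpere Ω u (Z ∩ interior Z) + mongeAmpere Ω u (Z ∩ frontier Z) := by
          unfold mongeAmpere
          rw [biUnion_union]
          exact measure_union_le _ _
      _ ≤ volume ({0} : Set (EuclideanSpace ℝ (Fin n))) + 0 :=
          add_le_add (measure_mono h1) h2.le
      _ = 0 := by simp
  have hupperA : mongeAmpere Ω u A ≤ ν (A ∩ D) := by
    have hsplit : A ⊆ (A ∩ D) ∪ Z := fun x hx => by
      rcases lt_or_ge 0 (u x) with h | h
      · exact Or.inl ⟨hx, hAΩ hx, h⟩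
      · exact Or.inr ⟨hAΩ hx, h⟩
    calc mongeAmpere Ω u A ≤ mongeAmpere Ω u ((A ∩ D) ∪ Z) := mongeAmpere_mono hsplit
      _ ≤ mongeAmpere Ω u (A ∩ D) + mongeAmpere Ω u Z := by
          unfold mongeAmpere
          rw [biUnion_union]
          exact measure_union_le _ _
      _ ≤ ν (A ∩ D) + 0 := add_le_add (hupper _ hADΩ) hMAZ
      _ = ν (A ∩ D) := add_zero _
  rw [le_antisymm hupperA hlower, hνA _ hAD hADΩ,
    ← lintegral_restrict_indicator hAD inter_subset_left]
  refine setLIntegral_congr_fun hA fun x hx => ?_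
  by_cases h : 0 < u x
  · simp [f, h, hD, hx, hAΩ hx]
  · simp [h, hD]

end Existence

/-! ### The comparison principle. -/

section Comparison

variable {n : ℕ} {Ω : Set (EuclideanSpace ℝ (Fin n))} {g u w : EuclideanSpace ℝ (Fin n) → ℝ}
  {q L : ℝ}

lemma le_of_mem_subdifferential_of_mem_closure (hu : ContinuousOn u (closure Ω))
    {x y p : EuclideanSpace ℝ (Fin n)} (hp : p ∈ subdifferential Ω u x) (hy : y ∈ closure Ω) :
    u x + inner ℝ p (y - x) ≤ u y := by
  refine ContinuousWithinAt.closure_le (s := Ω) (f := fun y => u x + (inner ℝ p (y - x) : ℝ))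
    (g := u) hy ?_ ((hu y hy).mono subset_closure) hp
  exact (by fun_prop : Continuous fun y : EuclideanSpace ℝ (Fin n) =>
    u x + (inner ℝ p (y - x) : ℝ)).continuousWithinAt

/-- An open set on which `u > 0` and `g u ^ q` integrates to zero is empty. -/
lemma eq_empty_of_lintegral_eq_zero (hg : AEMeasurable g (volume.restrict Ω))
    (hgpos : ∀ x ∈ Ω, 0 < g x) (hu : ContinuousOn u (closure Ω))
    {D : Set (EuclideanSpace ℝ (Fin n))} (hDo : IsOpen D) (hDΩ : D ⊆ Ω) (hDu : ∀ x ∈ D, 0 < u x)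
    (hI : ∫⁻ x in D, ENNReal.ofReal (g x * u x ^ q) = 0) : D = ∅ := by
  have hDm := hDo.measurableSet
  have hDmono := Measure.restrict_mono_set volume hDΩ
  have huD : AEMeasurable u (volume.restrict D) :=
    (hu.mono (hDΩ.trans subset_closure)).aemeasurable hDm
  have hae := (lintegral_eq_zero_iff'
    ((hg.mono_measure hDmono).mul (huD.pow_const q)).ennreal_ofReal).1 hI
  have hfalse : ∀ᵐ y ∂(volume.restrict D), False := by
    filter_upwards [hae, ae_restrict_mem hDm] with y hy hyD
    have h1 : g y * u y ^ q ≤ 0 := by simpa using hy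
    exact absurd h1 (not_le.2 (mul_pos (hgpos y (hDΩ hyD)) (Real.rpow_pos_of_pos (hDu y hyD) q)))
  have hD0 : volume D = 0 := by
    have := ae_iff.1 hfalse
    simpa using this
  exact (hDo.measure_eq_zero_iff volume).1 hD0

/-- The comparison principle for the subdifferentials of two functions on the set where their order
is opposite to the one on the boundary. -/
lemma biUnion_subdifferential_subset (hΩo : IsOpen Ω) (hΩb : Bornology.IsBounded Ω)
    (hu : ContinuousOn u (closure Ω)) (hw : ContinuousOn w (closure Ω)) {κ : ℝ}
    (h : ∀ x ∈ frontier Ω, u x ≤ w x + κ) :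
    (⋃ x ∈ {x | x ∈ Ω ∧ w x + κ < u x}, subdifferential Ω u x) ⊆
      ⋃ x ∈ {x | x ∈ Ω ∧ w x + κ < u x}, subdifferential Ω w x := by
  refine iUnion₂_subset fun x₀ hx₀ p hp => ?_
  -- Slide the plane of slope `p` until it touches `w` from below. The contact point still has `w +
  -- κ < u`, so it is not on the frontier.
  obtain ⟨x₁, hx₁, hmin⟩ := hΩb.isCompact_closure.exists_isMinOn ⟨x₀, subset_closure hx₀.1⟩
    (f := fun y => w y - (inner ℝ p y : ℝ))
    (hw.sub (by fun_prop : Continuous fun y : EuclideanSpace ℝ (Fin n) =>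
      (inner ℝ p y : ℝ)).continuousOn)
  have hmin' : ∀ y ∈ closure Ω, w x₁ - inner ℝ p x₁ ≤ w y - inner ℝ p y := fun y hy => hmin hy
  have h1 := le_of_mem_subdifferential_of_mem_closure hu hp hx₁
  have h2 := hmin' x₀ (subset_closure hx₀.1)
  rw [inner_sub_right] at h1
  have h3 : w x₁ + κ < u x₁ := by linarith [hx₀.2]
  have h4 : x₁ ∈ Ω := by
    by_contra hcon
    exact absurd (h x₁ ⟨hx₁, by rwa [hΩo.interior_eq]⟩) (not_le.2 h3)
  refine mem_iUnion₂.2 ⟨x₁, ⟨h4, h3⟩, fun y hy => ?_⟩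
  have h5 := hmin' y (subset_closure hy)
  rw [inner_sub_right]
  linarith

open scoped Pointwise in
/-- The comparison principle for solutions; it is here that `q < n` is used. -/
theorem IsSolution.le_add_of_frontier (hq : 0 ≤ q) (hqn : q < n) (hΩo : IsOpen Ω)
    (hΩb : Bornology.IsBounded Ω) (hg : AEMeasurable g (volume.restrict Ω))
    (hgpos : ∀ x ∈ Ω, 0 < g x) (hgL : ∀ x ∈ Ω, g x ≤ L) (hu : IsSolution Ω g q u)
    (hw : IsSolution Ω g q w) {κ : ℝ} (hκ : 0 ≤ κ) (h : ∀ x ∈ frontier Ω, u x ≤ w x + κ) :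
    ∀ x ∈ Ω, u x ≤ w x + κ := by
  obtain ⟨M₀, hM₀⟩ := (hΩb.isCompact_closure.image_of_continuousOn hu.continuousOn).bddAbove
  set M := max M₀ 0 with hMdef
  have hM0 : 0 ≤ M := le_max_right _ _
  have hM : ∀ x ∈ closure Ω, u x ≤ M := fun x hx =>
    (hM₀ (mem_image_of_mem u hx)).trans (le_max_left _ _)
  have key : ∀ ε : ℝ, 0 < ε → ∀ x ∈ Ω, (1 + ε) * u x - ε * M ≤ w x + κ := by
    intro ε hε x hx
    by_contra! hcon
    -- As `u ≤ M`, this stays below `u`, so the order on the boundary is kept, while the slopes are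
    -- multiplied by `1 + ε`.
    set ω : EuclideanSpace ℝ (Fin n) → ℝ := fun x => (1 + ε) * u x - ε * M with hω
    have hωc : ContinuousOn ω (closure Ω) := (hu.continuousOn.const_mul _).sub continuousOn_const
    set D := {x | x ∈ Ω ∧ w x + κ < ω x} with hD
    have hDΩ : D ⊆ Ω := fun x hx => hx.1
    have hDo : IsOpen D := by
      have := ((hωc.sub (hw.continuousOn.add (continuousOn_const (c := κ)))).mono
        subset_closure).isOpen_inter_preimage hΩo (isOpen_Ioi (a := (0 : ℝ)))
      convert this using 1
      ext y
      simp [hD]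
    have hDm := hDo.measurableSet
    have hDu : ∀ y ∈ D, 0 < u y := fun y hy => by
      have h1 := hw.nonneg y hy.1
      have h2 : w y + κ < (1 + ε) * u y - ε * M := hy.2
      have h3 : 0 < (1 + ε) * u y := by nlinarith
      exact (pos_iff_pos_of_mul_pos h3).1 (by linarith)
    have hsub := biUnion_subdifferential_subset hΩo hΩb hωc hw.continuousOn (κ := κ) fun y hy => by
      have := h y hy
      have h2 := hM y (frontier_subset_closure hy)
      simp only [hω]
      nlinarith
    have hsmul : (1 + ε) • (⋃ x ∈ D, subdifferential Ω u x) ⊆ ⋃ x ∈ D, subdifferential Ω ω x := by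
      rintro _ ⟨p, hp, rfl⟩
      obtain ⟨y, hy, hpy⟩ := mem_iUnion₂.1 hp
      refine mem_iUnion₂.2 ⟨y, hy, fun z hz => ?_⟩
      have h1 := mul_le_mul_of_nonneg_left (hpy z hz) (show 0 ≤ 1 + ε by linarith)
      simp only [hω, real_inner_smul_left]
      linarith
    have hMA : ENNReal.ofReal ((1 + ε) ^ n) * mongeAmpere Ω u D ≤ mongeAmpere Ω w D := by
      have h1 := measure_mono (μ := volume) (hsmul.trans hsub)
      rw [Measure.addHaar_smul, finrank_euclideanSpace_fin,
        abs_of_nonneg (by positivity : 0 ≤ (1 + ε) ^ n)] at h1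
      exact h1
    rw [hu.equation D hDm hDΩ, hw.equation D hDm hDΩ] at hMA
    set I := ∫⁻ x in D, ENNReal.ofReal (g x * u x ^ q) with hI
    have hIu : ∫⁻ x in D, ENNReal.ofReal (if 0 < u x then g x * u x ^ q else 0) = I :=
      setLIntegral_congr_fun hDm fun y hy => by simp [hDu y hy]
    have hIw : ∫⁻ x in D, ENNReal.ofReal (if 0 < w x then g x * w x ^ q else 0) ≤
        ENNReal.ofReal ((1 + ε) ^ q) * I := by
      rw [hI, ← lintegral_const_mul' _ _ ENNReal.ofReal_ne_top]
      refine setLIntegral_mono' hDm fun y hy => ?_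
      rw [← ENNReal.ofReal_mul (by positivity)]
      refine ENNReal.ofReal_le_ofReal ?_
      have hg0 := (hgpos y hy.1).le
      have hu0 := (hDu y hy).le
      split_ifs with hwy
      · have h2 : w y + κ < (1 + ε) * u y - ε * M := hy.2
        have h3 : w y ≤ (1 + ε) * u y := by nlinarith
        have h4 := Real.rpow_le_rpow hwy.le h3 hq
        rw [Real.mul_rpow (by linarith) hu0] at h4
        calc g y * w y ^ q ≤ g y * ((1 + ε) ^ q * u y ^ q) := by gcongr
          _ = _ := by ring
      · positivity
    rw [hIu] at hMA
    have hle := hMA.trans hIw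
    have hIfin : I ≠ ⊤ := by
      refine ne_top_of_le_ne_top ?_ (setLIntegral_mono' hDm
        (g := fun _ => ENNReal.ofReal (L * M ^ q)) fun y hy => ?_)
      · rw [setLIntegral_const]
        exact (ENNReal.mul_lt_top ENNReal.ofReal_lt_top (hΩb.subset hDΩ).measure_lt_top).ne
      · have h0 := (hDu y hy).le
        exact ENNReal.ofReal_le_ofReal (mul_le_mul (hgL y hy.1)
          (Real.rpow_le_rpow h0 (hM y (subset_closure hy.1)) hq) (by positivity)
          ((hgpos y hy.1).le.trans (hgL y hy.1)))
    -- Otherwise `(1 + ε) ^ n ≤ (1 + ε) ^ q`, against `q < n`.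
    have hI0 : I = 0 := by
      by_contra hne
      have h1 := (ENNReal.mul_le_mul_iff_left hne hIfin).1 hle
      have h2 := (ENNReal.ofReal_le_ofReal_iff (by positivity)).1 h1
      have h3 : (1 + ε) ^ q < (1 + ε) ^ (n : ℝ) :=
        Real.rpow_lt_rpow_of_exponent_lt (by linarith) hqn
      rw [Real.rpow_natCast] at h3
      exact absurd h2 (not_le.2 h3)
    exact notMem_empty x (eq_empty_of_lintegral_eq_zero hg hgpos hu.continuousOn hDo hDΩ hDu hI0 ▸
      (⟨hx, hcon⟩ : x ∈ D))
  intro x hx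
  have hlim : Tendsto (fun ε : ℝ => (1 + ε) * u x - ε * M) (𝓝[>] 0) (𝓝 (u x)) := by
    have : Tendsto (fun ε : ℝ => (1 + ε) * u x - ε * M) (𝓝 0)
        (𝓝 ((1 + 0) * u x - 0 * M)) := Continuous.tendsto (by fun_prop) 0
    simp only [add_zero, one_mul, zero_mul, sub_zero] at this
    exact this.mono_left nhdsWithin_le_nhds
  exact le_of_tendsto hlim (eventually_mem_nhdsWithin.mono fun ε hε => key ε hε x hx)

end Comparison

/-! ### Convexity and closures. -/

section Convexity

lemma convexOn_closure {E : Type*} [NormedAddCommGroup E] [NormedSpace ℝ E] {Ω : Set E} {f : E → ℝ}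
    (hf : ConvexOn ℝ Ω f) (hc : ContinuousOn f (closure Ω)) : ConvexOn ℝ (closure Ω) f := by
  refine ⟨hf.1.closure, fun x hx y hy a b ha hb hab => ?_⟩
  have hxy : ((x, y) : E × E) ∈ closure (Ω ×ˢ Ω) := by
    rw [closure_prod_eq]; exact ⟨hx, hy⟩
  have hsub : Ω ×ˢ Ω ⊆ closure Ω ×ˢ closure Ω := prod_mono subset_closure subset_closure
  refine ContinuousWithinAt.closure_le (s := Ω ×ˢ Ω) (f := fun z : E × E => f (a • z.1 + b • z.2))
    (g := fun z : E × E => a • f z.1 + b • f z.2) hxy ?_ ?_ ?_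
  · have h1 : ContinuousOn (fun z : E × E => f (a • z.1 + b • z.2)) (closure Ω ×ˢ closure Ω) :=
      hc.comp (by fun_prop) fun z hz => hf.1.closure hz.1 hz.2 ha hb hab
    exact (h1 (x, y) ⟨hx, hy⟩).mono hsub
  · have h1 : ContinuousOn (fun z : E × E => a • f z.1 + b • f z.2) (closure Ω ×ˢ closure Ω) :=
      ((hc.comp continuousOn_fst fun z hz => hz.1).const_smul a).add
        ((hc.comp continuousOn_snd fun z hz => hz.2).const_smul b)
    exact (h1 (x, y) ⟨hx, hy⟩).mono hsub
  · exact fun z hz => hf.2 hz.1 hz.2 ha hb hab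

/-- A convex set whose closure contains an open set contains that open set. -/
lemma subset_of_subset_closure_of_convex {E : Type*} [NormedAddCommGroup E] [NormedSpace ℝ E]
    [FiniteDimensional ℝ E] {Ω A : Set E} (hΩo : IsOpen Ω) (hΩne : Ω.Nonempty)
    (hA : Convex ℝ A) (h : Ω ⊆ closure A) : Ω ⊆ A := by
  have hspan : affineSpan ℝ A = ⊤ := by
    have hcl : IsClosed (affineSpan ℝ A : Set E) := AffineSubspace.closed_of_finiteDimensional _
    have h1 : Ω ⊆ affineSpan ℝ A := h.trans (closure_minimal (subset_affineSpan ℝ A) hcl)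
    rw [eq_top_iff, ← hΩo.affineSpan_eq_top hΩne]
    exact affineSpan_le.2 h1
  have hint := hA.interior_nonempty_iff_affineSpan_eq_top.2 hspan
  rw [← hΩo.subset_interior_iff, hA.interior_closure_eq_interior_of_nonempty_interior hint] at h
  exact h.trans interior_subset

end Convexity

/-! ### Solutions and affine functions. -/

section Solutions

variable {n : ℕ} {Ω : Set (EuclideanSpace ℝ (Fin n))} {g v : EuclideanSpace ℝ (Fin n) → ℝ} {q : ℝ}

/-- A solution that is affine on the whole domain vanishes. -/
lemma IsSolution.eq_zero_of_isLinearOn (hn : 0 < n) (hΩo : IsOpen Ω)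
    (hg : AEMeasurable g (volume.restrict Ω)) (hgpos : ∀ x ∈ Ω, 0 < g x)
    (hv : IsSolution Ω g q v) (hl : IsLinearOn v Ω) : ∀ x ∈ Ω, v x = 0 := by
  have hnt := nontrivial_euclideanSpace hn
  obtain ⟨p, c, hpc⟩ := hl
  have hDo : IsOpen {x | x ∈ Ω ∧ 0 < v x} :=
    (hv.continuousOn.mono subset_closure).isOpen_inter_preimage hΩo (isOpen_Ioi (a := (0 : ℝ)))
  set D := {x | x ∈ Ω ∧ 0 < v x} with hD
  have hDΩ : D ⊆ Ω := fun x hx => hx.1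
  have hMA : mongeAmpere Ω v D = 0 := by
    refine measure_mono_null (iUnion₂_subset fun x hx => ?_) (measure_singleton p)
    refine subdifferential_subset_of_eventuallyEq (c := c) ?_
    filter_upwards [hΩo.mem_nhds hx.1] with y hy using ⟨hy, hpc y hy⟩
  rw [hv.equation D hDo.measurableSet hDΩ] at hMA
  have hI : ∫⁻ x in D, ENNReal.ofReal (g x * v x ^ q) = 0 := by
    rw [← hMA]
    exact setLIntegral_congr_fun hDo.measurableSet fun y hy => by simp [hy.2]
  have hempty := eq_empty_of_lintegral_eq_zero hg hgpos hv.continuousOn hDo hDΩ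
    (fun x hx => hx.2) hI
  intro x hx
  refine le_antisymm (not_lt.1 fun h => ?_) (hv.nonneg x hx)
  exact notMem_empty x (hempty ▸ (⟨hx, h⟩ : x ∈ D))

/-- A convex function is dominated on a compact convex set by any affine function that dominates it
at the extreme points. -/
lemma le_affine_of_extremePoints_le {u : EuclideanSpace ℝ (Fin n) → ℝ}
    {A : Set (EuclideanSpace ℝ (Fin n))} (huc : ConvexOn ℝ (closure Ω) u)
    (hu : ContinuousOn u (closure Ω)) (hA : IsCompact A) (hAc : Convex ℝ A)
    {p : EuclideanSpace ℝ (Fin n)} {c : ℝ}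
    (hext : ∀ x ∈ A.extremePoints ℝ, x ∈ closure Ω ∧ u x ≤ inner ℝ p x + c) :
    ∀ x ∈ A, u x ≤ inner ℝ p x + c := by
  -- By Krein–Milman it suffices that this sublevel set is closed, convex and contains the extreme
  -- points.
  have hSc : Convex ℝ {x | x ∈ closure Ω ∧ u x - inner ℝ p x ≤ c} := by
    have h1 : ConcaveOn ℝ (closure Ω) fun x : EuclideanSpace ℝ (Fin n) => (inner ℝ p x : ℝ) :=
      (innerSL ℝ p).toLinearMap.concaveOn huc.1
    exact (huc.sub h1).convex_le c
  have hScl : IsClosed {x | x ∈ closure Ω ∧ u x - inner ℝ p x ≤ c} :=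
    (hu.sub (by fun_prop : Continuous fun y : EuclideanSpace ℝ (Fin n) =>
      (inner ℝ p y : ℝ)).continuousOn).preimage_isClosed_of_isClosed isClosed_closure isClosed_Iic
  intro x hx
  rw [← closure_convexHull_extremePoints hA hAc] at hx
  have := closure_minimal (convexHull_min (fun y hy => ?_) hSc) hScl hx
  · linarith [this.2]
  · have := hext y hy
    exact ⟨this.1, by linarith [this.2]⟩

end Solutions

end MongeAmpereObstacle

/-! ### The perturbed family. -/

open MongeAmpereObstacle in
theorem proposition3 (n : ℕ) (q : ℝ) (hq0 : 0 ≤ q) (hqn : q < n)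
    (Ω : Set (EuclideanSpace ℝ (Fin n)))
    (hΩo : IsOpen Ω) (hΩc : Convex ℝ Ω) (hΩb : Bornology.IsBounded Ω)
    (g : EuclideanSpace ℝ (Fin n) → ℝ)
    (hgm : AEMeasurable g (volume.restrict Ω))
    (hgpos : ∀ x ∈ Ω, 0 < g x) (hgbdd : ∃ L : ℝ, ∀ x ∈ Ω, g x ≤ L)
    (v : EuclideanSpace ℝ (Fin n) → ℝ)
    (hv : MongeAmpereObstacle.IsSolution Ω g q v)
    (E : Set (EuclideanSpace ℝ (Fin n)))
    (hEc : Convex ℝ E) (hEs : E ⊆ MongeAmpereObstacle.singularSet Ω v)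
    (hEl : MongeAmpereObstacle.IsLinearOn v E)
    (hEx : (closure E).extremePoints ℝ ⊆ frontier Ω)
    (hne : ¬ (E = Ω ∧ ∀ x ∈ Ω, v x = 0)) :
    ∃ w : ℝ → EuclideanSpace ℝ (Fin n) → ℝ,
      (∀ t : ℝ, 0 < t → MongeAmpereObstacle.IsSolution Ω g q (w t)) ∧
      TendstoUniformlyOn w v (𝓝[>] (0 : ℝ)) (closure Ω) ∧
      (∀ t : ℝ, 0 < t →
        (∀ x ∈ closure Ω, v x ≤ w t x) ∧ (∃ x ∈ Ω, w t x ≠ v x)) ∧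
      (∀ t : ℝ, 0 < t → ∀ x ∈ E, w t x = v x) ∧
      (E ⊆ frontier (MongeAmpereObstacle.coincidenceSet Ω v) →
        ∀ t : ℝ, 0 < t →
          E ⊆ frontier (MongeAmpereObstacle.coincidenceSet Ω (w t))) := by
  have hn : 0 < n := by
    have : (0 : ℝ) < n := hq0.trans_lt hqn
    exact_mod_cast this
  have hEΩ : E ⊆ Ω := hEs.trans (sUnion_subset fun F hF => hF.1)
  have hcl : ∀ x ∈ closure Ω, x ∉ Ω → x ∈ frontier Ω := fun x hx h =>
    ⟨hx, by rwa [hΩo.interior_eq]⟩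
  obtain ⟨p, c, hpc⟩ := hEl
  -- If `E` were dense in `Ω`, convexity would force `E = Ω`; then `v` is affine on `Ω`, hence zero,
  -- which is excluded.
  obtain ⟨y, hyΩ, hyE⟩ : ∃ y ∈ Ω, y ∉ closure E := by
    by_contra! hdense
    rcases Ω.eq_empty_or_nonempty with he | hΩne
    · exact hne ⟨by rw [he] at hEΩ ⊢; exact subset_empty_iff.1 hEΩ, by simp [he]⟩
    have hE : E = Ω := hEΩ.antisymm (subset_of_subset_closure_of_convex hΩo hΩne hEc hdense)
    exact hne ⟨hE, hv.eq_zero_of_isLinearOn hn hΩo hgm hgpos ⟨p, c, hE ▸ hpc⟩⟩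
  have hΩne : Ω.Nonempty := ⟨y, hyΩ⟩
  have hF := frontier_nonempty_of_isBounded hn hΩb hΩne
  obtain ⟨L, hgL⟩ := hgbdd
  obtain ⟨f, s, hfE, hfy⟩ := geometric_hahn_banach_closed_point hEc.closure isClosed_closure hyE
  let h : EuclideanSpace ℝ (Fin n) → ℝ := fun x => max (f x - s) 0
  have hhc : Continuous h := by fun_prop
  have hh0 : ∀ x, 0 ≤ h x := fun x => le_max_right _ _
  have hhE : ∀ x ∈ closure E, h x = 0 := fun x hx => max_eq_right (by linarith [hfE x hx])
  have hhconv : ConvexOn ℝ (closure Ω) h :=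
    (ConvexOn.sub (f.toLinearMap.convexOn hΩc.closure) (concaveOn_const s hΩc.closure)).sup (convexOn_const 0 hΩc.closure)
  have hvc : ConvexOn ℝ (closure Ω) v := convexOn_closure hv.convexOn hv.continuousOn
  have hv0 : ∀ x ∈ closure Ω, 0 ≤ v x := fun x hx =>
    ContinuousWithinAt.closure_le (s := Ω) (f := fun _ => (0 : ℝ)) (g := v) hx
      continuousWithinAt_const ((hv.continuousOn x hx).mono subset_closure) hv.nonneg
  obtain ⟨H, hH⟩ := (hΩb.isCompact_closure.image_of_continuousOn hhc.continuousOn).bddAbove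
  have hhH : ∀ x ∈ closure Ω, h x ≤ H := fun x hx => hH (mem_image_of_mem h hx)
  have hH0 : 0 ≤ H := (hh0 y).trans (hhH y (subset_closure hyΩ))
  have hex : ∀ t : ℝ, ∃ u, 0 < t →
      IsSolution Ω g q u ∧ ∀ x ∈ frontier Ω, u x = v x + t * h x := by
    intro t
    by_cases ht : 0 < t
    · obtain ⟨u, hu⟩ := exists_isSolution (φ := fun x => v x + t * h x) hn hq0 hΩo hΩc hΩb hΩne hgm
        (fun x hx => (hgpos x hx).le) hgL (hvc.add (hhconv.smul ht.le))
        (hv.continuousOn.add (hhc.continuousOn.const_smul t))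
        fun x hx => add_nonneg (hv0 x hx) (mul_nonneg ht.le (hh0 x))
      exact ⟨u, fun _ => hu⟩
    · exact ⟨v, fun ht' => absurd ht' ht⟩
  choose w hw using hex
  have hle : ∀ t, 0 < t → ∀ x ∈ closure Ω, v x ≤ w t x := by
    intro t ht x hx
    by_cases hxΩ : x ∈ Ω
    · have := hv.le_add_of_frontier hq0 hqn hΩo hΩb hgm hgpos hgL (hw t ht).1 le_rfl
        (fun z hz => by
          rw [(hw t ht).2 z hz]
          linarith [mul_nonneg ht.le (hh0 z)]) x hxΩ
      linarith
    · rw [(hw t ht).2 x (hcl x hx hxΩ)]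
      linarith [mul_nonneg ht.le (hh0 x)]
  have hge : ∀ t, 0 < t → ∀ x ∈ closure Ω, w t x ≤ v x + t * H := by
    intro t ht x hx
    have hb : ∀ z ∈ frontier Ω, w t z ≤ v z + t * H := fun z hz => by
      rw [(hw t ht).2 z hz]
      linarith [mul_le_mul_of_nonneg_left (hhH z (frontier_subset_closure hz)) ht.le]
    by_cases hxΩ : x ∈ Ω
    · exact (hw t ht).1.le_add_of_frontier hq0 hqn hΩo hΩb hgm hgpos hgL hv
        (mul_nonneg ht.le hH0) hb x hxΩ
    · exact hb x (hcl x hx hxΩ)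
  have hwE : ∀ t, 0 < t → ∀ x ∈ E, w t x = v x := by
    intro t ht x hx
    have hclE : closure E ⊆ closure Ω := closure_mono hEΩ
    have hpc' : EqOn v (fun x => inner ℝ p x + c) (closure E) :=
      EqOn.of_subset_closure (s := E) (fun z hz => hpc z hz) (hv.continuousOn.mono hclE)
        (by fun_prop) subset_closure le_rfl
    refine le_antisymm ?_ (hle t ht x (subset_closure (hEΩ hx)))
    rw [hpc x hx]
    refine le_affine_of_extremePoints_le
      (convexOn_closure (hw t ht).1.convexOn (hw t ht).1.continuousOn) (hw t ht).1.continuousOn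
      (hΩb.subset hEΩ).isCompact_closure hEc.closure (fun z hz => ?_) x (subset_closure hx)
    have hzE := extremePoints_subset hz
    refine ⟨hclE hzE, ?_⟩
    rw [(hw t ht).2 z (hEx hz), hhE z hzE, hpc' hzE]
    simp
  refine ⟨w, fun t ht => (hw t ht).1, ?_, fun t ht => ⟨hle t ht, ?_⟩, hwE, fun hEK t ht x hx => ?_⟩
  · rw [Metric.tendstoUniformlyOn_iff]
    intro ε hε
    have hδ : 0 < ε / (H + 1) := by positivity
    filter_upwards [Ioo_mem_nhdsGT hδ] with t ht x hx
    have h1 := hle t ht.1 x hx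
    have h2 := hge t ht.1 x hx
    have h3 : t * (H + 1) < ε := (lt_div_iff₀ (by positivity)).1 ht.2
    rw [dist_comm, Real.dist_eq, abs_of_nonneg (by linarith)]
    linarith [ht.1]
  · by_contra! hcon
    have heq : EqOn (w t) v (closure Ω) :=
      EqOn.of_subset_closure (s := Ω) hcon (hw t ht).1.continuousOn hv.continuousOn
        subset_closure le_rfl
    -- A frontier point where `f` is at least `f y > s`: there the data exceed `v` by `t * h b > 0`.
    obtain ⟨b, hb, hyb⟩ := exists_frontier_inner_le hΩo hΩb hF (subset_closure hyΩ)
      ((InnerProductSpace.toDual ℝ _).symm f)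
    rw [InnerProductSpace.toDual_symm_apply, InnerProductSpace.toDual_symm_apply] at hyb
    have h1 := heq (frontier_subset_closure hb)
    rw [(hw t ht).2 b hb] at h1
    have h2 : 0 < h b := lt_max_of_lt_left (by linarith)
    linarith [mul_pos ht h2]
  · have hxΩ := hEΩ hx
    have hvx : v x = 0 := by
      have hcw : ContinuousWithinAt v (coincidenceSet Ω v) x :=
        (hv.continuousOn x (subset_closure hxΩ)).mono fun z hz => subset_closure hz.1
      have hxc : x ∈ closure (coincidenceSet Ω v) := frontier_subset_closure (hEK hx)
      refine le_antisymm ?_ (hv.nonneg x hxΩ)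
      exact ContinuousWithinAt.closure_le (f := v) (g := fun _ => (0 : ℝ)) hxc hcw
        continuousWithinAt_const fun z hz => hz.2.le
    refine ⟨subset_closure ⟨hxΩ, by rw [hwE t ht x hx, hvx]⟩, fun hxi => (hEK hx).2 ?_⟩
    have hsub : coincidenceSet Ω (w t) ⊆ coincidenceSet Ω v := fun z hz =>
      ⟨hz.1, le_antisymm ((hle t ht z (subset_closure hz.1)).trans hz.2.le) (hv.nonneg z hz.1)⟩
    exact interior_mono hsub hxi
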